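/- Let $d\ge 5$ and let $(S_k)_{k\ge 0}$ be the symmetric nearest-neighbour random walk on $\mathbb Z^d$ with $S_0=0$ and law $\mathbb P_0$. For $n\in\mathbb N$ and $x\in\mathbb Z^d$ let $l_n(x)=\sum_{k=0}^n \mathbf 1\{S_k=x\}$ be the local time, let $l_\infty(x)=\sum_{k\ge 0}\mathbf 1\{S_k=x\}$, and let $G_d(x)=\mathbb E_0[l_\infty(x)]$ be the Green kernel. With the convention $\log 0=-\infty$: 1. For every $\epsilon>0$ and every $y>1+2\sum_{x\in\mathbb Z^d}G_d(x)^2$, $$\limsup_{n\to\infty}\frac1{\sqrt n}\log \mathbb P_0\Big(\sum_{x:\,l_n(x)\le n^{1/2-\epsilon}} l_n^2(x)\ge ny\Big)=-\infty .$$ 2. For every $y>0$ and every $\epsilon>0$ such that $\epsilon<\tfrac12$ or $y>1+2\sum_{x\in\mathbb Z^d}G_d(x)^2$, there is a constant $\tilde c>0$ such that $$\limsup_{n\to\infty}\frac1{\sqrt n}\log \mathbb P_0\Big(\sum_{x:\,l_n(x)> n^{1/2-\epsilon}} l_n^2(x)\ge ny\Big)\le-\tilde c .$$ -/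

import Mathlib

open MeasureTheory ProbabilityTheory Filter
open scoped ENNReal

noncomputable section

namespace SimpleWalk

/-- A nearest-neighbour step in `ℤ^d`: a coordinate direction together with a sign. -/
abbrev Step (d : ℕ) : Type := Fin d × Bool

/-- The vector `± e_i` of `ℤ^d` encoded by a step. -/
def stepVec {d : ℕ} (s : Step d) : Fin d → ℤ :=
  if s.2 then Pi.single s.1 1 else -Pi.single s.1 1

/-- The law `P₀` of the simple random walk started at the origin, carried by the space of
sequences of steps: the steps are independent and each is uniform among the `2 d` unit steps. -/
def walkLaw (d : ℕ) : Measure (ℕ → Step d) :=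
  Measure.infinitePi fun _ : ℕ => uniformOn (Set.univ : Set (Step d))

/-- The position `S_k` of the walk at time `k`; in particular `S_0 = 0`. -/
def position {d : ℕ} (k : ℕ) (ω : ℕ → Step d) : Fin d → ℤ :=
  ∑ i ∈ Finset.range k, stepVec (ω i)

/-- The local time `l_n(x)`: the number of times `k` with `0 ≤ k ≤ n` and `S_k = x`. -/
def localTime {d : ℕ} (n : ℕ) (x : Fin d → ℤ) (ω : ℕ → Step d) : ℕ :=
  ((Finset.range (n + 1)).filter fun k => position k ω = x).card

/-- The total local time `l_∞(x)`: the number of times `k ≥ 0` with `S_k = x`, possibly infinite. -/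
def totalLocalTime {d : ℕ} (x : Fin d → ℤ) (ω : ℕ → Step d) : ℝ≥0∞ :=
  ((Set.encard {k : ℕ | position k ω = x} : ℕ∞) : ℝ≥0∞)

/-- The Green kernel `G_d(x) = E₀[l_∞(x)]`. -/
def green (d : ℕ) (x : Fin d → ℤ) : ℝ≥0∞ :=
  ∫⁻ ω, totalLocalTime x ω ∂(walkLaw d)

/-- The sum of `l_n(x)^2` over the sites with `l_n(x) ≤ t`.  Only the finitely many visited sites
give a nonzero term. -/
def lowSum {d : ℕ} (n : ℕ) (t : ℝ) (ω : ℕ → Step d) : ℝ :=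
  ∑' x : {x : Fin d → ℤ // (localTime n x ω : ℝ) ≤ t}, (localTime n x.1 ω : ℝ) ^ 2

/-- The sum of `l_n(x)^2` over the sites with `l_n(x) > t`.  Only the finitely many visited sites
give a nonzero term. -/
def highSum {d : ℕ} (n : ℕ) (t : ℝ) (ω : ℕ → Step d) : ℝ :=
  ∑' x : {x : Fin d → ℤ // t < (localTime n x ω : ℝ)}, (localTime n x.1 ω : ℝ) ^ 2

/-- `limsup_{n → ∞} n^{-1/2} log p_n`, in the extended reals, with `log 0 = -∞`. -/
def sqrtRate (p : ℕ → ℝ≥0∞) : EReal :=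
  limsup (fun n : ℕ => ((1 / √(n : ℝ) : ℝ) : EReal) * ENNReal.log (p n)) atTop

end SimpleWalk

end

noncomputable section

namespace SimpleWalk

variable {d : ℕ}

/-! Write `g = ∑ G_d(x)²`, finite because `d ≥ 5`. The sum of `l_n(x)²` is `n + 1` plus twice the
number of pairs `i < j ≤ n` with `S_i = S_j`. Every such pair is separated by the midpoint of a
dyadic block containing both times. At level `l` there are about `n / 2^(l+1)` blocks, hence about
`n` in all; in each, the reversed past and the future of the midpoint are independent walks, whose
mean number of intersections is at most `g`. This explains the threshold `1 + 2g`.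

Low local times. On sites with `l_n(x) ≤ T = n^(1/2-ε)` the intersections in a block form an
additive functional of the future, with charge `min (visits of the past) T`. Suppose the potential
of this charge is at most `s` on the past (`Spread`). Khasminskii's argument then bounds the
exponential moment at `λ < 1/s` by `1 + λ g / (1 - λ s)` (`lintegral_crossWeight_le`), so the
first-order term has the right constant. Blocks of one level are independent, and Markov's
inequality leaves only an error of order `λ² s g n` (`exp_mul_pow_le`). `Spread` fails rarely
(`measure_not_spread_le`): truncation controls the first `r` steps of the future by `r T`, and the
later ones give an additive functional of the past whose potential is `O(r^(-1/8))`. With suitable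
powers of `n` for `r`, `s`, `λ`, both errors are smaller than `exp (-c √n)` for every `c`
(`decays_sum_dyadicCross`).

High local times. A set of `j` sites has potential `O(j^(4/9))`, so spending time `τ j` in it costs
`exp (-const * τ j^(5/9))`. If the `j`-th largest local time stays below `b √n j^(-5/9)`, its square
is at most `b² n j^(-10/9)`, which is summable in `j`. Hence a contribution of order `n` needs an
exception of cost `exp (-c √n)`; the number of candidate sets is harmless while `j` is at most about
`n^(1/4)`, and having that many sites above `n^(3/8)` is more expensive still
(`exists_decays_highSum`).

For the second claim, sites above `n^(3/8)` are handled this way. If `ε < 1/2`, the remaining sites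
have local time above any constant, so only pairs in different blocks of length `2^l₀` matter; their
mean is at most about `n g / 2^l₀`, as small as desired. Otherwise the remaining sites are covered
by the first claim. -/

instance stepProb [NeZero d] :
    IsProbabilityMeasure (uniformOn (Set.univ : Set (Step d))) :=
  isProbabilityMeasure_uniformOn Set.finite_univ Set.univ_nonempty

instance walkLawProb [NeZero d] : IsProbabilityMeasure (walkLaw d) := by
  unfold walkLaw; infer_instance

/-! ### Cutting and reversing the walk -/

/-- The walk that follows `u` for `a` steps and then `v`. -/
def splice (a : ℕ) (u v : ℕ → Step d) : ℕ → Step d :=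
  fun i => if i < a then u i else v (i - a)

/-- The opposite step. -/
def flip (s : Step d) : Step d := (s.1, !s.2)

/-- The first `m` steps, reversed in time and in sign. -/
def rev (m : ℕ) (u : ℕ → Step d) : ℕ → Step d :=
  fun i => if i < m then flip (u (m - 1 - i)) else u i

/-- The steps after time `m`. -/
def future (m : ℕ) (u : ℕ → Step d) : ℕ → Step d := fun i => u (m + i)

lemma flip_flip (s : Step d) : flip (flip s) = s := by simp [flip]

lemma stepVec_flip (s : Step d) : stepVec (flip s) = -stepVec s := by
  rcases s with ⟨j, b⟩
  cases b <;> simp [stepVec, flip]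

/-- A function of finitely many steps is measurable. -/
lemma measurable_of_dependsOn {β : Type*} [MeasurableSpace β] (N : ℕ)
    {F : (ℕ → Step d) → β} (h : ∀ u v, (∀ i < N, u i = v i) → F u = F v) : Measurable F := by
  classical
  rcases Nat.eq_zero_or_pos d with rfl | hd
  · have : IsEmpty (ℕ → Step 0) := ⟨fun u => (u 0).1.elim0⟩
    exact measurable_of_empty F
  let s0 : Step d := (⟨0, hd⟩, true)
  have h2 : F = (fun w : Fin N → Step d => F (fun i => if hi : i < N then w ⟨i, hi⟩ else s0)) ∘
      (fun u (i : Fin N) => u i) := by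
    funext u
    apply h
    intro i hi
    simp [hi]
  rw [h2]
  exact (measurable_of_finite _).comp (by fun_prop)

/-- The relabelling `σ` of the coordinates lets the same cylinder formula serve the shift in
`splice` and the time reversal in `rev`. -/
lemma walkLaw_forall_mem [NeZero d] (s : Finset ℕ) (t : ℕ → Set (Step d)) (σ : ℕ → ℕ)
    (hσ : Set.InjOn σ s) :
    walkLaw d {u | ∀ i ∈ s, u (σ i) ∈ t i} = ∏ i ∈ s, uniformOn (Set.univ : Set (Step d)) (t i) := by
  classical
  let τ := Function.invFunOn σ (s : Set ℕ)
  have hτ : ∀ i ∈ s, τ (σ i) = i := fun i hi => hσ.leftInvOn_invFunOn (by exact_mod_cast hi)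
  have : {u : ℕ → Step d | ∀ i ∈ s, u (σ i) ∈ t i} =
      Set.pi (s.image σ : Finset ℕ) (fun j => t (τ j)) := by
    ext u
    simp only [Set.mem_ofPred_eq, Set.mem_pi, Finset.coe_image, Set.mem_image,
      forall_exists_index, and_imp, forall_apply_eq_imp_iff₂, Finset.mem_coe]
    exact forall₂_congr fun i hi => by rw [hτ i hi]
  rw [this, walkLaw, Measure.infinitePi_pi _ (fun _ _ => Set.Finite.measurableSet (Set.toFinite _)),
    Finset.prod_image hσ]
  exact Finset.prod_congr rfl fun i hi => by rw [hτ i hi]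

lemma measurable_splice (a : ℕ) :
    Measurable fun p : (ℕ → Step d) × (ℕ → Step d) => splice a p.1 p.2 := by
  refine measurable_pi_lambda _ fun i => ?_
  unfold splice
  by_cases hi : i < a
  · simp only [hi, if_true]; fun_prop
  · simp only [hi, if_false]; fun_prop

lemma measurePreserving_splice [NeZero d] (a : ℕ) :
    MeasurePreserving (fun p : (ℕ → Step d) × (ℕ → Step d) => splice a p.1 p.2)
      ((walkLaw d).prod (walkLaw d)) (walkLaw d) := by
  classical
  refine ⟨measurable_splice a, ?_⟩
  conv_rhs => rw [walkLaw]
  refine Measure.eq_infinitePi _ fun s t ht => ?_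
  rw [Measure.map_apply (measurable_splice a)
    (MeasurableSet.pi s.countable_toSet fun _ _ => Set.Finite.measurableSet (Set.toFinite _))]
  have : (fun p : (ℕ → Step d) × (ℕ → Step d) => splice a p.1 p.2) ⁻¹' Set.pi s t =
      {u | ∀ i ∈ s.filter (· < a), u (id i) ∈ t i} ×ˢ
        {v | ∀ i ∈ s.filter (¬ · < a), v (i - a) ∈ t i} := by
    ext ⟨u, v⟩
    simp only [Set.mem_preimage, Set.mem_pi, Set.mem_prod, Set.mem_ofPred_eq, Finset.mem_filter,
      Finset.mem_coe, splice, id]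
    constructor
    · intro h
      exact ⟨fun i hi => by simpa [hi.2] using h i hi.1, fun i hi => by simpa [hi.2] using h i hi.1⟩
    · rintro ⟨h1, h2⟩ i hi
      by_cases hia : i < a
      · simpa [hia] using h1 i ⟨hi, hia⟩
      · simpa [hia] using h2 i ⟨hi, hia⟩
  rw [this, Measure.prod_prod, walkLaw_forall_mem _ _ _ Function.injective_id.injOn,
    walkLaw_forall_mem _ _ (fun i => i - a), Finset.prod_filter_mul_prod_filter_not]
  intro i hi j hj hij
  simp only [Finset.coe_filter, Set.mem_ofPred_eq] at hi hj
  simp only at hij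
  omega

lemma uniformOn_preimage_flip (t : Set (Step d)) :
    uniformOn (Set.univ : Set (Step d)) (flip ⁻¹' t) = uniformOn Set.univ t := by
  rw [uniformOn_univ, uniformOn_univ, Measure.count_apply, Measure.count_apply]
  · congr 2
    have : Function.Involutive (flip (d := d)) := flip_flip
    rw [← this.image_eq_preimage_symm]
    exact this.injective.encard_image t
  all_goals exact Set.Finite.measurableSet (Set.toFinite _)

lemma measurable_rev (m : ℕ) : Measurable (rev (d := d) m) := by
  refine measurable_pi_lambda _ fun i => ?_
  unfold rev
  by_cases hi : i < m
  · simp only [hi, if_true]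
    exact (measurable_of_finite flip).comp (measurable_pi_apply _)
  · simp only [hi, if_false]; fun_prop

/-- Permuting independent identically distributed steps preserves their law, and so does `flip`, a
bijection of the uniform step space. -/
lemma measurePreserving_rev [NeZero d] (m : ℕ) :
    MeasurePreserving (rev (d := d) m) (walkLaw d) (walkLaw d) := by
  classical
  refine ⟨measurable_rev m, ?_⟩
  conv_rhs => rw [walkLaw]
  refine Measure.eq_infinitePi _ fun s t ht => ?_
  rw [Measure.map_apply (measurable_rev m)
    (MeasurableSet.pi s.countable_toSet fun _ _ => Set.Finite.measurableSet (Set.toFinite _))]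
  have : rev m ⁻¹' Set.pi s t =
      {u : ℕ → Step d | ∀ i ∈ s, u (if i < m then m - 1 - i else i) ∈
        (if i < m then flip ⁻¹' t i else t i)} := by
    ext u
    simp only [Set.mem_preimage, Set.mem_pi, Finset.mem_coe, rev, Set.mem_ofPred_eq]
    refine forall₂_congr fun i hi => ?_
    split_ifs <;> simp
  rw [this, walkLaw_forall_mem s (fun i => if i < m then flip ⁻¹' t i else t i)
    (fun i => if i < m then m - 1 - i else i)]
  · refine Finset.prod_congr rfl fun i hi => ?_
    split_ifs
    · exact uniformOn_preimage_flip _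
    · rfl
  · intro i hi j hj hij
    simp only at hij
    split_ifs at hij <;> omega

/-- The Markov property at a fixed time. Dependence on finitely many steps serves only to make `F`
measurable. -/
lemma lintegral_splice [NeZero d] (a N : ℕ) {F : (ℕ → Step d) → ℝ≥0∞}
    (h : ∀ u v, (∀ i < N, u i = v i) → F u = F v) :
    ∫⁻ ω, F ω ∂walkLaw d = ∫⁻ u, ∫⁻ v, F (splice a u v) ∂walkLaw d ∂walkLaw d := by
  have hF := measurable_of_dependsOn N h
  rw [← (measurePreserving_splice a).lintegral_comp hF, lintegral_prod]
  exact (hF.comp (measurable_splice a)).aemeasurable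

@[simp] lemma position_zero (ω : ℕ → Step d) : position 0 ω = 0 := by simp [position]

lemma position_succ (k : ℕ) (ω : ℕ → Step d) :
    position (k + 1) ω = position k ω + stepVec (ω k) := Finset.sum_range_succ _ _

lemma position_congr {k : ℕ} {u v : ℕ → Step d} (h : ∀ i < k, u i = v i) :
    position k u = position k v :=
  Finset.sum_congr rfl fun i hi => by rw [h i (Finset.mem_range.1 hi)]

lemma position_add (m k : ℕ) (ω : ℕ → Step d) :
    position (m + k) ω = position m ω + position k (future m ω) :=
  Finset.sum_range_add _ _ _

lemma future_splice (m : ℕ) (u v : ℕ → Step d) : future m (splice m u v) = v := by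
  funext i; simp [future, splice]

lemma splice_of_lt {a i : ℕ} (h : i < a) (u v : ℕ → Step d) : splice a u v i = u i := by
  simp [splice, h]

lemma position_splice_of_le {a k : ℕ} (h : k ≤ a) (u v : ℕ → Step d) :
    position k (splice a u v) = position k u :=
  position_congr fun _ hi => splice_of_lt (by omega) u v

lemma position_splice_add (a k : ℕ) (u v : ℕ → Step d) :
    position (a + k) (splice a u v) = position a u + position k v := by
  rw [position_add, future_splice, position_splice_of_le le_rfl]

/-- Undoing the last `k` steps is the same as walking from `S_m` along the first `k` steps of the
reversed walk. -/
lemma position_rev {m k : ℕ} (hk : k ≤ m) (ω : ℕ → Step d) :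
    position (m - k) ω = position m ω + position k (rev m ω) := by
  induction k with
  | zero => simp
  | succ k ih =>
    have h1 := ih (by omega)
    rw [position_succ, ← add_assoc, ← h1]
    have h2 : m - k = m - (k + 1) + 1 := by omega
    rw [h2, position_succ, rev, if_pos (by omega), stepVec_flip]
    have h3 : m - 1 - k = m - (k + 1) := by omega
    rw [h3, add_neg_cancel_right]

lemma rev_congr {m : ℕ} {u v : ℕ → Step d} (h : ∀ i < m, u i = v i) :
    ∀ i < m, rev m u i = rev m v i := by
  intro i hi
  simp only [rev, hi, if_true]
  rw [h _ (by omega)]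

/-- The reversed past and the future of the walk at time `m` are independent walks. -/
lemma lintegral_rev_future [NeZero d] (m N : ℕ) {F : (ℕ → Step d) → (ℕ → Step d) → ℝ≥0∞}
    (h : ∀ u v u' v', (∀ i < m, u i = u' i) → (∀ i < N, v i = v' i) → F u v = F u' v') :
    ∫⁻ ω, F (rev m ω) (future m ω) ∂walkLaw d = ∫⁻ u, ∫⁻ v, F u v ∂walkLaw d ∂walkLaw d := by
  rw [lintegral_splice m (m + N)]
  · have h1 : ∀ u v : ℕ → Step d, F (rev m (splice m u v)) (future m (splice m u v)) =
        F (rev m u) v := by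
      intro u v
      rw [future_splice]
      exact h _ _ _ _ (rev_congr fun i hi => splice_of_lt hi u v) fun _ _ => rfl
    simp_rw [h1]
    refine (measurePreserving_rev m).lintegral_comp (f := fun u => ∫⁻ v, F u v ∂walkLaw d) ?_
    refine measurable_of_dependsOn m fun u v huv => ?_
    exact lintegral_congr fun w => h _ _ _ _ huv fun _ _ => rfl
  · intro u v huv
    refine h _ _ _ _ (rev_congr fun i hi => huv i (by omega)) fun i hi => huv _ (by omega)

/-! ### Potentials and Khasminskii's exponential bound -/

/-- The potential `∑ₖ E[f(z + S_k)]` of a nonnegative function. -/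
def potential (f : (Fin d → ℤ) → ℝ≥0∞) (z : Fin d → ℤ) : ℝ≥0∞ :=
  ∑' k : ℕ, ∫⁻ ω, f (z + position k ω) ∂walkLaw d

lemma measurable_comp_position {β : Type*} [MeasurableSpace β] (f : (Fin d → ℤ) → β) (k : ℕ) :
    Measurable fun ω : ℕ → Step d => f (position k ω) :=
  measurable_of_dependsOn k fun u v h => by rw [position_congr h]

lemma measurable_comp_step {β : Type*} [MeasurableSpace β] (f : Step d → β) (k : ℕ) :
    Measurable fun ω : ℕ → Step d => f (ω k) :=
  (measurable_of_finite f).comp (measurable_pi_apply k)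

lemma position_one (ω : ℕ → Step d) : position 1 ω = stepVec (ω 0) := by simp [position]

lemma potential_eq [NeZero d] (f : (Fin d → ℤ) → ℝ≥0∞) (z : Fin d → ℤ) :
    potential f z = f z + ∫⁻ ω, potential f (z + stepVec (ω 0)) ∂walkLaw d := by
  rw [potential, tsum_eq_zero_add' ENNReal.summable]
  simp only [position_zero, add_zero, lintegral_const, measure_univ, mul_one]
  congr 1
  unfold potential
  rw [lintegral_tsum]
  · refine tsum_congr fun k => ?_
    rw [lintegral_splice 1 (k + 1) (fun u v h => by rw [position_congr h])]
    simp_rw [add_comm k 1, position_splice_add, position_one, add_assoc]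
  · exact fun k => (measurable_comp_step
      (fun s => ∫⁻ ω, f (z + stepVec s + position k ω) ∂walkLaw d) 0).aemeasurable

/-- A supersolution of the Feynman-Kac equation dominates the Feynman-Kac functional. -/
lemma lintegral_prod_le [NeZero d] {φ w : (Fin d → ℤ) → ℝ≥0∞} (hw : ∀ z, 1 ≤ w z)
    (h : ∀ z, φ z * ∫⁻ ω, w (z + stepVec (ω 0)) ∂walkLaw d ≤ w z) (N : ℕ) (z : Fin d → ℤ) :
    ∫⁻ ω, ∏ k ∈ Finset.range N, φ (z + position k ω) ∂walkLaw d ≤ w z := by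
  induction N generalizing z with
  | zero => simpa using hw z
  | succ N ih =>
    rw [lintegral_splice 1 (N + 1)]
    · have : ∀ u v : ℕ → Step d, ∏ k ∈ Finset.range (N + 1), φ (z + position k (splice 1 u v)) =
          φ z * ∏ k ∈ Finset.range N, φ (z + stepVec (u 0) + position k v) := by
        intro u v
        rw [Finset.prod_range_succ', mul_comm]
        simp_rw [add_comm _ 1, position_splice_add, position_one, position_zero, add_zero,
          add_assoc]
      simp_rw [this]
      refine le_trans ?_ (h z)
      calc _ ≤ ∫⁻ u, φ z * w (z + stepVec (u 0)) ∂walkLaw d := by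
            refine lintegral_mono fun u => ?_
            rw [lintegral_const_mul]
            · exact mul_le_mul_right (ih _) _
            · exact Finset.measurable_prod _ fun k _ =>
                measurable_comp_position (fun x => φ (z + stepVec (u 0) + x)) k
        _ = _ := lintegral_const_mul _ (measurable_comp_step (fun s => w (z + stepVec s)) 0)
    · intro u v huv
      refine Finset.prod_congr rfl fun k hk => ?_
      rw [position_congr fun i hi => huv i (by have := Finset.mem_range.1 hk; omega)]

/-- With `X` the mean potential after one step, this is the supersolution inequality for `1 + a U`,
where `U = f + X`. It follows from `exp (λ f) ≤ 1 / (1 - λ f)`; the coefficient `a = λ / (1 - λ s)`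
is the solution of `λ (1 + a s) = a`. -/
lemma exp_mul_le_of_potential {lam s f X : ℝ} (hlam : 0 ≤ lam) (hs : lam * s < 1) (hf : 0 ≤ f)
    (hX : 0 ≤ X) (hfs : f + X ≤ s) :
    Real.exp (lam * f) * (1 + lam / (1 - lam * s) * X) ≤
      1 + lam / (1 - lam * s) * (f + X) := by
  have h1 : lam * f ≤ lam * s := mul_le_mul_of_nonneg_left (by linarith) hlam
  have h2 : 0 < 1 - lam * f := by linarith
  have h3 : Real.exp (lam * f) ≤ 1 / (1 - lam * f) := by
    rw [le_div_iff₀ h2]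
    have := Real.add_one_le_exp (-(lam * f))
    calc Real.exp (lam * f) * (1 - lam * f) ≤ Real.exp (lam * f) * Real.exp (-(lam * f)) := by
          gcongr; linarith
      _ = 1 := by rw [← Real.exp_add]; simp
  have h4 : 0 < 1 - lam * s := by linarith
  set a := lam / (1 - lam * s) with ha
  have ha0 : 0 ≤ a := div_nonneg hlam h4.le
  have ha1 : lam * (1 + a * s) = a := by rw [ha]; field_simp; ring
  calc Real.exp (lam * f) * (1 + a * X) ≤ 1 / (1 - lam * f) * (1 + a * X) := by gcongr
    _ ≤ 1 + a * (f + X) := by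
      rw [one_div, inv_mul_le_iff₀ h2]
      have h5 : lam * (1 + a * (f + X)) ≤ a := by exact (by gcongr : lam * (1 + a * (f + X)) ≤ lam * (1 + a * s)).trans ha1.le
      nlinarith [mul_le_mul_of_nonneg_left h5 hf]

/-- Khasminskii's exponential bound for additive functionals of the walk. -/
lemma lintegral_exp_le [NeZero d] {f : (Fin d → ℤ) → ℝ} (hf : ∀ x, 0 ≤ f x) {lam s : ℝ}
    (hlam : 0 ≤ lam) (hs : lam * s < 1)
    (h : ∀ z, f z ≠ 0 → potential (fun x => ENNReal.ofReal (f x)) z ≤ ENNReal.ofReal s)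
    (N : ℕ) (z : Fin d → ℤ) :
    ∫⁻ ω, ENNReal.ofReal (Real.exp (lam * ∑ k ∈ Finset.range N, f (z + position k ω)))
      ∂walkLaw d ≤ 1 + ENNReal.ofReal (lam / (1 - lam * s)) *
        potential (fun x => ENNReal.ofReal (f x)) z := by
  set U := potential (fun x => ENNReal.ofReal (f x)) with hU
  set a := lam / (1 - lam * s) with ha
  have ha0 : 0 ≤ a := div_nonneg hlam (by linarith)
  have key := lintegral_prod_le (d := d) (φ := fun x => ENNReal.ofReal (Real.exp (lam * f x)))
    (w := fun x => 1 + ENNReal.ofReal a * U x) (fun z => le_self_add) ?_ N z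
  · refine le_trans (le_of_eq ?_) key
    refine lintegral_congr fun ω => ?_
    rw [Finset.mul_sum, Real.exp_sum, ENNReal.ofReal_prod_of_nonneg fun _ _ => (Real.exp_pos _).le]
  intro z
  have hm := measurable_comp_step (d := d) (fun s => U (z + stepVec s)) 0
  rw [lintegral_add_left measurable_const, lintegral_const_mul _ hm, lintegral_const, measure_univ,
    mul_one]
  have h1 : U z = ENNReal.ofReal (f z) + ∫⁻ ω, U (z + stepVec (ω 0)) ∂walkLaw d :=
    potential_eq _ z
  rw [h1]
  -- Off the support of `f` the supersolution inequality is an equality, so the bound `s` on the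
  -- potential is needed on the support only.
  by_cases hz : f z = 0
  · simp [hz]
  have h2 := h z hz
  rw [h1] at h2
  generalize ∫⁻ ω, U (z + stepVec (ω 0)) ∂walkLaw d = X at h2 ⊢
  have hXt : X ≠ ⊤ := ne_top_of_le_ne_top ENNReal.ofReal_ne_top (le_trans le_add_self h2)
  obtain ⟨x, hx, rfl⟩ : ∃ x : ℝ, 0 ≤ x ∧ X = ENNReal.ofReal x :=
    ⟨X.toReal, ENNReal.toReal_nonneg, (ENNReal.ofReal_toReal hXt).symm⟩
  have hf0 : 0 < f z := lt_of_le_of_ne (hf z) (Ne.symm hz)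
  rw [← ENNReal.ofReal_add (hf z) hx] at h2 ⊢
  have h3 : f z + x ≤ s := (ENNReal.ofReal_le_ofReal_iff'.1 h2).resolve_right (by linarith)
  rw [← ENNReal.ofReal_mul ha0, ← ENNReal.ofReal_mul ha0, ← ENNReal.ofReal_one,
    ← ENNReal.ofReal_add zero_le_one (by positivity),
    ← ENNReal.ofReal_add zero_le_one (mul_nonneg ha0 (by linarith)),
    ← ENNReal.ofReal_mul (Real.exp_pos _).le]
  exact ENNReal.ofReal_le_ofReal (exp_mul_le_of_potential hlam hs (hf z) hx h3)

/-- Markov's inequality for the exponential of a random variable. -/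
lemma measure_le_exp_mul_lintegral {Ω : Type*} [MeasurableSpace Ω] {μ : Measure Ω} {X : Ω → ℝ}
    (hX : Measurable X) (lam u : ℝ) (hlam : 0 ≤ lam) :
    μ {ω | u ≤ X ω} ≤ ENNReal.ofReal (Real.exp (-(lam * u))) *
      ∫⁻ ω, ENNReal.ofReal (Real.exp (lam * X ω)) ∂μ := by
  have h1 : {ω | u ≤ X ω} ⊆
      {ω | ENNReal.ofReal (Real.exp (lam * u)) ≤ ENNReal.ofReal (Real.exp (lam * X ω))} := by
    intro ω hω
    exact ENNReal.ofReal_le_ofReal (Real.exp_le_exp.2 (mul_le_mul_of_nonneg_left hω hlam))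
  refine (measure_mono h1).trans ?_
  have h2 := mul_meas_ge_le_lintegral (μ := μ)
    (f := fun ω => ENNReal.ofReal (Real.exp (lam * X ω))) (by fun_prop)
    (ENNReal.ofReal (Real.exp (lam * u)))
  calc _ = ENNReal.ofReal (Real.exp (-(lam * u))) * (ENNReal.ofReal (Real.exp (lam * u)) *
        μ {ω | ENNReal.ofReal (Real.exp (lam * u)) ≤ ENNReal.ofReal (Real.exp (lam * X ω))}) := by
        rw [← mul_assoc, ← ENNReal.ofReal_mul (Real.exp_pos _).le, ← Real.exp_add]
        simp
    _ ≤ _ := by gcongr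

/-- Exponential tail of an additive functional with bounded potential. -/
lemma measure_sum_ge_le [NeZero d] {f : (Fin d → ℤ) → ℝ} (hf : ∀ x, 0 ≤ f x) {σ : ℝ} (hσ : 0 < σ)
    (h : ∀ z, potential (fun x => ENNReal.ofReal (f x)) z ≤ ENNReal.ofReal σ)
    (N : ℕ) (u : ℝ) :
    walkLaw d {ω | u ≤ ∑ k ∈ Finset.range N, f (position k ω)} ≤
      ENNReal.ofReal (2 * Real.exp (-(u / (2 * σ)))) := by
  have hm : Measurable fun ω : ℕ → Step d => ∑ k ∈ Finset.range N, f (position k ω) :=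
    Finset.measurable_sum _ fun k _ => measurable_comp_position f k
  -- With `λ = 1 / (2σ)`, half the critical value, the exponential moment is at most `1 + (1/σ) σ =
  -- 2`.
  refine (measure_le_exp_mul_lintegral hm (1 / (2 * σ)) u (by positivity)).trans ?_
  have h1 := lintegral_exp_le hf (lam := 1 / (2 * σ)) (s := σ) (by positivity)
    (by rw [div_mul_eq_mul_div, div_lt_one (by positivity)]; linarith) (fun z _ => h z) N 0
  simp only [zero_add] at h1
  have h2 : 1 / (2 * σ) / (1 - 1 / (2 * σ) * σ) = 1 / σ := by field_simp; norm_num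
  rw [h2] at h1
  have h3 : (1 : ℝ≥0∞) + ENNReal.ofReal (1 / σ) *
      potential (fun x => ENNReal.ofReal (f x)) (0 : Fin d → ℤ) ≤ 2 := by
    calc _ ≤ (1 : ℝ≥0∞) + ENNReal.ofReal (1 / σ) * ENNReal.ofReal σ := by gcongr; exact h 0
      _ = 2 := by
        rw [← ENNReal.ofReal_mul (by positivity), one_div_mul_cancel hσ.ne', ENNReal.ofReal_one]
        norm_num
  rw [mul_comm (2 : ℝ) (Real.exp _), ENNReal.ofReal_mul (Real.exp_pos _).le]
  refine mul_le_mul' (le_of_eq (by congr 3; ring)) ((h1.trans h3).trans (by simp))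

/-! ### Heat kernel decay by Fourier inversion -/

/-- The transition probability `P(S_k = x)`. -/
def heat (d k : ℕ) (x : Fin d → ℤ) : ℝ≥0∞ := walkLaw d {ω | position k ω = x}

lemma measurableSet_of_dependsOn (N : ℕ) {p : (ℕ → Step d) → Prop}
    (h : ∀ u v, (∀ i < N, u i = v i) → (p u ↔ p v)) : MeasurableSet {ω | p ω} := by
  have : Measurable p := measurable_of_dependsOn N fun u v huv => propext (h u v huv)
  exact measurableSet_setOfPred.2 this

lemma measurableSet_position_eq (k : ℕ) (x : Fin d → ℤ) :
    MeasurableSet {ω : ℕ → Step d | position k ω = x} :=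
  measurableSet_of_dependsOn k fun u v h => by rw [position_congr h]

lemma heat_eq_lintegral (k : ℕ) (x : Fin d → ℤ) :
    heat d k x = ∫⁻ ω, (if position k ω = x then 1 else 0) ∂walkLaw d := by
  rw [heat, ← lintegral_indicator_one (measurableSet_position_eq k x)]
  refine lintegral_congr fun ω => ?_
  by_cases h : position k ω = x <;> simp [h]

lemma lintegral_step [NeZero d] (f : Step d → ℝ≥0∞) :
    ∫⁻ ω, f (ω 0) ∂walkLaw d = (∑ s, f s) / (2 * d) := by
  have h := (measurePreserving_eval_infinitePi
    (fun _ : ℕ => uniformOn (Set.univ : Set (Step d))) 0).lintegral_comp (measurable_of_finite f)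
  rw [walkLaw]
  simp only [Function.eval] at h
  rw [h, lintegral_fintype, div_eq_mul_inv, Finset.sum_mul]
  refine Finset.sum_congr rfl fun s _ => ?_
  rw [uniformOn_univ, Measure.count_singleton]
  simp [mul_comm]

lemma heat_zero [NeZero d] (x : Fin d → ℤ) : heat d 0 x = if x = 0 then 1 else 0 := by
  rw [heat_eq_lintegral]
  simp [eq_comm]

lemma heat_succ [NeZero d] (k : ℕ) (x : Fin d → ℤ) :
    heat d (k + 1) x = (∑ s, heat d k (x - stepVec s)) / (2 * d) := by
  rw [heat_eq_lintegral, lintegral_splice 1 (k + 1) (fun u v h => by rw [position_congr h]),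
    ← lintegral_step]
  refine lintegral_congr fun u => ?_
  rw [heat_eq_lintegral]
  refine lintegral_congr fun v => ?_
  rw [add_comm k 1, position_splice_add, position_one]
  simp [eq_sub_iff_add_eq']

lemma heat_le_one [NeZero d] (k : ℕ) (x : Fin d → ℤ) : heat d k x ≤ 1 := prob_le_one

lemma toReal_heat_succ [NeZero d] (k : ℕ) (x : Fin d → ℤ) :
    (heat d (k + 1) x).toReal = (∑ s, (heat d k (x - stepVec s)).toReal) / (2 * d) := by
  rw [heat_succ, ENNReal.toReal_div,
    ENNReal.toReal_sum fun s _ => ne_top_of_le_ne_top ENNReal.one_ne_top (heat_le_one _ _)]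
  simp

/-- Lebesgue measure on the cube `(-π, π]^d`. -/
def cubeMeasure (d : ℕ) : Measure (Fin d → ℝ) :=
  Measure.pi fun _ => volume.restrict (Set.Ioc (-Real.pi) Real.pi)

instance : IsFiniteMeasure (cubeMeasure d) := by unfold cubeMeasure; infer_instance

/-- The characteristic function of one step. -/
def stepChar (θ : Fin d → ℝ) : ℝ := (∑ j, Real.cos (θ j)) / d

/-- The character `θ ↦ exp(-i θ·x)`. -/
def character (x : Fin d → ℤ) (θ : Fin d → ℝ) : ℂ :=
  ∏ j, Complex.exp (-(Complex.I * x j) * θ j)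

lemma norm_character (x : Fin d → ℤ) (θ : Fin d → ℝ) : ‖character x θ‖ = 1 := by
  rw [character, norm_prod]
  refine Finset.prod_eq_one fun j _ => ?_
  rw [Complex.norm_exp]
  simp

lemma character_sub (x y : Fin d → ℤ) (θ : Fin d → ℝ) :
    character (x - y) θ = character x θ * character (-y) θ := by
  rw [character, character, character, ← Finset.prod_mul_distrib]
  refine Finset.prod_congr rfl fun j _ => ?_
  rw [← Complex.exp_add]
  congr 1
  simp only [Pi.sub_apply, Pi.neg_apply]
  push_cast
  ring

lemma character_single (j : Fin d) (a : ℤ) (θ : Fin d → ℝ) :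
    character (Pi.single j a) θ = Complex.exp (-(Complex.I * a) * θ j) := by
  rw [character, Finset.prod_eq_single j]
  · simp
  · intro b _ hb
    simp [hb]
  · simp

lemma sum_character_step [NeZero d] (θ : Fin d → ℝ) :
    ∑ s : Step d, character (-stepVec s) θ = 2 * d * stepChar θ := by
  have hd : (d : ℂ) ≠ 0 := by exact_mod_cast NeZero.ne d
  rw [Fintype.sum_prod_type, stepChar]
  push_cast
  rw [mul_assoc, mul_div_cancel₀ _ hd, Finset.mul_sum]
  refine Finset.sum_congr rfl fun j _ => ?_
  have h1 : character (-stepVec ((j, true) : Step d)) θ = Complex.exp (θ j * Complex.I) := by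
    have : -stepVec ((j, true) : Step d) = Pi.single j (-1) := by simp [stepVec, Pi.single_neg]
    rw [this, character_single]
    congr 1; push_cast; ring
  have h2 : character (-stepVec ((j, false) : Step d)) θ = Complex.exp (-θ j * Complex.I) := by
    have : -stepVec ((j, false) : Step d) = Pi.single j 1 := by simp [stepVec]
    rw [this, character_single]
    congr 1; push_cast; ring
  rw [Fintype.sum_bool, h1, h2, Complex.cos]
  ring

lemma continuous_character (x : Fin d → ℤ) : Continuous (character x) := by
  unfold character; fun_prop

lemma continuous_stepChar : Continuous (stepChar (d := d)) := by
  unfold stepChar; fun_prop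

lemma abs_stepChar_le_one [NeZero d] (θ : Fin d → ℝ) : |stepChar θ| ≤ 1 := by
  have hd : (0 : ℝ) < d := by exact_mod_cast Nat.pos_of_ne_zero (NeZero.ne d)
  rw [stepChar, abs_div, Nat.abs_cast, div_le_one hd]
  refine (Finset.abs_sum_le_sum_abs _ _).trans ?_
  refine (Finset.sum_le_card_nsmul _ _ 1 fun j _ => Real.abs_cos_le_one _).trans (by simp)

lemma integrable_stepChar_mul [NeZero d] (k : ℕ) (x : Fin d → ℤ) :
    Integrable (fun θ => (stepChar θ : ℂ) ^ k * character x θ) (cubeMeasure d) := by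
  refine Integrable.of_bound ?_ 1 (ae_of_all _ fun θ => ?_)
  · have h1 := continuous_character x
    have h2 := continuous_stepChar (d := d)
    exact Continuous.aestronglyMeasurable (by fun_prop)
  · rw [norm_mul, norm_character, mul_one, norm_pow, Complex.norm_real]
    exact pow_le_one₀ (norm_nonneg _) (abs_stepChar_le_one θ)

lemma integral_character (x : Fin d → ℤ) :
    ∫ θ, character x θ ∂cubeMeasure d = if x = 0 then (2 * Real.pi : ℂ) ^ d else 0 := by
  have h1 : ∀ a : ℤ, ∫ t in Set.Ioc (-Real.pi) Real.pi, Complex.exp (-(Complex.I * a) * t) =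
      if a = 0 then (2 * Real.pi : ℂ) else 0 := by
    intro a
    rw [← intervalIntegral.integral_of_le (by linarith [Real.pi_pos])]
    split_ifs with h
    · subst h
      simp
      ring
    · have hc : -(Complex.I * a) ≠ 0 := by simp [h]
      rw [integral_exp_mul_complex hc, div_eq_zero_iff]
      left
      rw [sub_eq_zero, Complex.exp_eq_exp_iff_exists_int]
      exact ⟨-a, by push_cast; ring⟩
  unfold character cubeMeasure
  rw [integral_fintype_prod_eq_prod (f := fun j (t : ℝ) => Complex.exp (-(Complex.I * x j) * t))]
  simp_rw [h1]
  split_ifs with h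
  · subst h; simp
  · obtain ⟨j, hj⟩ := Function.ne_iff.1 h
    exact Finset.prod_eq_zero (Finset.mem_univ j) (by simpa using hj)

/-- Fourier inversion for the transition probabilities. -/
lemma heat_fourier [NeZero d] (k : ℕ) (x : Fin d → ℤ) :
    ((heat d k x).toReal : ℂ) * (2 * Real.pi) ^ d =
      ∫ θ, (stepChar θ : ℂ) ^ k * character x θ ∂cubeMeasure d := by
  induction k generalizing x with
  | zero =>
    simp only [pow_zero, one_mul, integral_character, heat_zero]
    split_ifs <;> simp
  | succ k ih =>
    have hd : (d : ℂ) ≠ 0 := by exact_mod_cast NeZero.ne d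
    have h1 : ∀ θ : Fin d → ℝ, (stepChar θ : ℂ) ^ (k + 1) * character x θ =
        (∑ s, (stepChar θ : ℂ) ^ k * character (x - stepVec s) θ) / (2 * d) := by
      intro θ
      simp_rw [character_sub, ← mul_assoc]
      rw [← Finset.mul_sum, sum_character_step]
      field_simp
      ring
    simp_rw [h1]
    rw [integral_div, integral_finsetSum _ fun s _ => integrable_stepChar_mul k _]
    simp_rw [← ih]
    rw [toReal_heat_succ]
    push_cast
    rw [← Finset.sum_mul]
    ring

/-- Cauchy-Schwarz bounds the squared mean of the cosines by one minus the mean of the `sin²`. Using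
`sin²` treats the maxima of `|stepChar|` at `0` and at `(π, …, π)` alike, as the periodicity of the
walk requires, and the bound factors over coordinates. -/
lemma abs_stepChar_pow_le [NeZero d] (k : ℕ) (θ : Fin d → ℝ) :
    |stepChar θ| ^ k ≤ ∏ j, Real.exp (-(k / (2 * d)) * Real.sin (θ j) ^ 2) := by
  have hd : (0 : ℝ) < d := by exact_mod_cast Nat.pos_of_ne_zero (NeZero.ne d)
  set S := ∑ j, Real.sin (θ j) ^ 2 with hS
  have h1 : stepChar θ ^ 2 ≤ 1 - S / d := by
    have h2 := sq_sum_le_card_mul_sum_sq (s := Finset.univ) (f := fun j => Real.cos (θ j))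
    have h3 : ∑ j, Real.cos (θ j) ^ 2 = d - S := by
      simp_rw [Real.cos_sq', Finset.sum_sub_distrib]
      simp [hS]
    rw [h3, Finset.card_univ, Fintype.card_fin] at h2
    rw [stepChar, div_pow, div_le_iff₀ (by positivity)]
    refine h2.trans (le_of_eq ?_)
    field_simp
  have h2 : |stepChar θ| ≤ Real.exp (-(S / d) / 2) := by
    rw [Real.exp_half]
    refine Real.abs_le_sqrt (h1.trans ?_)
    linarith [Real.add_one_le_exp (-(S / d))]
  calc |stepChar θ| ^ k ≤ Real.exp (-(S / d) / 2) ^ k := by gcongr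
    _ = _ := by
      rw [← Real.exp_nat_mul, ← Real.exp_sum, ← Finset.mul_sum, ← hS]
      congr 1
      field_simp

lemma exp_sin_sq_le {a t : ℝ} (ha : 0 ≤ a) (h1 : -Real.pi ≤ t) (h2 : t ≤ Real.pi) :
    Real.exp (-a * Real.sin t ^ 2) ≤ Real.exp (-(a * (4 / Real.pi ^ 2)) * (t + Real.pi) ^ 2) +
      Real.exp (-(a * (4 / Real.pi ^ 2)) * t ^ 2) +
      Real.exp (-(a * (4 / Real.pi ^ 2)) * (t - Real.pi) ^ 2) := by
  have hpi := Real.pi_pos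
  have key : ∀ u : ℝ, |u| ≤ Real.pi / 2 → Real.sin u ^ 2 = Real.sin t ^ 2 →
      Real.exp (-a * Real.sin t ^ 2) ≤ Real.exp (-(a * (4 / Real.pi ^ 2)) * u ^ 2) := by
    intro u hu hs
    refine Real.exp_le_exp.2 ?_
    have h3 : 2 / Real.pi * |u| ≤ Real.sin |u| := Real.mul_le_sin (abs_nonneg u) hu
    have h4 : Real.sin |u| ^ 2 = Real.sin u ^ 2 := by
      rcases abs_cases u with h | h <;> simp [h.1]
    have h5 : (2 / Real.pi * |u|) ^ 2 ≤ Real.sin t ^ 2 := by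
      rw [← hs, ← h4]; gcongr
    rw [mul_pow, sq_abs] at h5
    have h6 : (2 / Real.pi) ^ 2 = 4 / Real.pi ^ 2 := by ring
    rw [h6] at h5
    nlinarith [mul_le_mul_of_nonneg_left h5 ha]
  have p1 := Real.exp_pos (-(a * (4 / Real.pi ^ 2)) * (t + Real.pi) ^ 2)
  have p2 := Real.exp_pos (-(a * (4 / Real.pi ^ 2)) * t ^ 2)
  have p3 := Real.exp_pos (-(a * (4 / Real.pi ^ 2)) * (t - Real.pi) ^ 2)
  rcases le_total t (-(Real.pi / 2)) with h | h
  · have := key (t + Real.pi) (by rw [abs_of_nonneg] <;> linarith) (by rw [Real.sin_add_pi]; ring)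
    linarith
  rcases le_total t (Real.pi / 2) with h' | h'
  · have := key t (abs_le.2 ⟨h, h'⟩) rfl
    linarith
  · have := key (t - Real.pi) (by rw [abs_of_nonpos] <;> linarith)
      (by rw [Real.sin_sub_pi]; ring)
    linarith

/-- Jordan's inequality puts a Gaussian at each of the zeros `-π`, `0`, `π` of the sine; each is
then integrated over the whole line. -/
lemma integral_exp_sin_sq_le {a : ℝ} (ha : 0 < a) :
    ∫ t in Set.Ioc (-Real.pi) Real.pi, Real.exp (-a * Real.sin t ^ 2) ≤
      3 * √(Real.pi / (a * (4 / Real.pi ^ 2))) := by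
  have hpi := Real.pi_pos
  set b := a * (4 / Real.pi ^ 2) with hb
  have hb0 : 0 < b := by positivity
  have i0 := integrable_exp_neg_mul_sq hb0
  have i1 : Integrable fun t : ℝ => Real.exp (-b * (t + Real.pi) ^ 2) := i0.comp_add_right Real.pi
  have i2 : Integrable fun t : ℝ => Real.exp (-b * (t - Real.pi) ^ 2) := i0.comp_sub_right Real.pi
  have i3 : Integrable fun t : ℝ => Real.exp (-b * (t + Real.pi) ^ 2) + Real.exp (-b * t ^ 2) +
      Real.exp (-b * (t - Real.pi) ^ 2) := (i1.add i0).add i2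
  calc _ ≤ ∫ t in Set.Ioc (-Real.pi) Real.pi, (Real.exp (-b * (t + Real.pi) ^ 2) +
        Real.exp (-b * t ^ 2) + Real.exp (-b * (t - Real.pi) ^ 2)) := by
        refine setIntegral_mono_on ?_ i3.integrableOn measurableSet_Ioc
          fun t ht => exp_sin_sq_le ha.le ht.1.le ht.2
        exact (Continuous.integrableOn_Icc (by fun_prop)).mono_set Set.Ioc_subset_Icc_self
    _ ≤ ∫ t, (Real.exp (-b * (t + Real.pi) ^ 2) +
        Real.exp (-b * t ^ 2) + Real.exp (-b * (t - Real.pi) ^ 2)) :=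
        setIntegral_le_integral i3 (ae_of_all _ fun t => by positivity)
    _ = 3 * √(Real.pi / b) := by
        have i4 : Integrable fun t : ℝ =>
            Real.exp (-b * (t + Real.pi) ^ 2) + Real.exp (-b * t ^ 2) := i1.add i0
        rw [integral_add i4 i2, integral_add i1 i0,
          integral_add_right_eq_self (fun t : ℝ => Real.exp (-b * t ^ 2)),
          integral_sub_right_eq_self (fun t : ℝ => Real.exp (-b * t ^ 2)), integral_gaussian]
        ring

lemma toReal_heat_le [NeZero d] {k : ℕ} (hk : 0 < k) (x : Fin d → ℤ) :
    (heat d k x).toReal ≤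
      (3 * √(Real.pi / ((k / (2 * d)) * (4 / Real.pi ^ 2)))) ^ d := by
  have hd : (0 : ℝ) < d := by exact_mod_cast Nat.pos_of_ne_zero (NeZero.ne d)
  have hk' : (0 : ℝ) < k := by exact_mod_cast hk
  have hpi := Real.pi_gt_three
  have h1 : (heat d k x).toReal * (2 * Real.pi) ^ d =
      ‖∫ θ, (stepChar θ : ℂ) ^ k * character x θ ∂cubeMeasure d‖ := by
    rw [← heat_fourier, norm_mul, norm_pow, norm_mul, Complex.norm_real, Complex.norm_real]
    simp [abs_of_pos Real.pi_pos]
  have h2 : (heat d k x).toReal ≤ (heat d k x).toReal * (2 * Real.pi) ^ d :=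
    le_mul_of_one_le_right ENNReal.toReal_nonneg (one_le_pow₀ (by linarith))
  refine h2.trans (h1.le.trans ((norm_integral_le_integral_norm _).trans ?_))
  calc _ ≤ ∫ θ : Fin d → ℝ, ∏ j, Real.exp (-(k / (2 * d)) * Real.sin (θ j) ^ 2)
        ∂cubeMeasure d := by
        refine integral_mono_of_nonneg (ae_of_all _ fun θ => norm_nonneg _) ?_
          (ae_of_all _ fun θ => ?_)
        · refine Integrable.of_bound (Continuous.aestronglyMeasurable (by fun_prop)) 1
            (ae_of_all _ fun θ => ?_)
          rw [norm_prod]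
          refine Finset.prod_le_one (fun j _ => norm_nonneg _) fun j _ => ?_
          rw [Real.norm_eq_abs, Real.abs_exp, Real.exp_le_one_iff, neg_mul, Left.neg_nonpos_iff]
          positivity
        · simp only [norm_mul, norm_character, mul_one, norm_pow, Complex.norm_real]
          exact abs_stepChar_pow_le k θ
    _ = (∫ t in Set.Ioc (-Real.pi) Real.pi, Real.exp (-(k / (2 * d)) * Real.sin t ^ 2)) ^ d := by
        rw [cubeMeasure, integral_fintype_prod_eq_pow
          (fun t : ℝ => Real.exp (-(k / (2 * d)) * Real.sin t ^ 2)), Fintype.card_fin]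
    _ ≤ _ := by
        refine pow_le_pow_left₀ (integral_nonneg fun t => (Real.exp_pos _).le) ?_ d
        exact integral_exp_sin_sq_le (by positivity)

/-- In dimension at least five the transition probabilities decay like `k ^ (-5/2)`. -/
lemma exists_heat_le (hd : 5 ≤ d) : ∃ C : ℝ, 0 < C ∧ ∀ (k : ℕ) (x : Fin d → ℤ),
    heat d k x ≤ ENNReal.ofReal (C * ((k : ℝ) + 1) ^ (-(5 / 2) : ℝ)) := by
  have : NeZero d := ⟨by omega⟩
  have hd0 : (0 : ℝ) < d := by exact_mod_cast Nat.pos_of_ne_zero (NeZero.ne d)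
  have hpi := Real.pi_pos
  set c : ℝ := 3 * √(Real.pi ^ 3 * d / 2) with hc
  have hc0 : 0 ≤ c := by positivity
  -- The factor `2 ^ (5/2)` pays for replacing `k` by `k + 1` when `k ≥ 1`; the summand `1` covers
  -- `k = 0`.
  refine ⟨c ^ d * 2 ^ (5 / 2 : ℝ) + 1, by positivity, fun k x => ?_⟩
  rw [← ENNReal.ofReal_toReal (ne_top_of_le_ne_top ENNReal.one_ne_top (heat_le_one k x))]
  refine ENNReal.ofReal_le_ofReal ?_
  rcases Nat.eq_zero_or_pos k with rfl | hk
  · have h1 : (heat d 0 x).toReal ≤ 1 := ENNReal.toReal_le_of_le_ofReal zero_le_one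
      (by simpa using heat_le_one 0 x)
    refine h1.trans ?_
    simp only [Nat.cast_zero, zero_add, Real.one_rpow, mul_one]
    have : 0 ≤ c ^ d * 2 ^ (5 / 2 : ℝ) := by positivity
    linarith
  · have hk' : (1 : ℝ) ≤ k := by exact_mod_cast hk
    refine (toReal_heat_le hk x).trans ?_
    have h1 : Real.pi / ((k / (2 * d)) * (4 / Real.pi ^ 2)) = (Real.pi ^ 3 * d / 2) * (k : ℝ)⁻¹ := by
      field_simp; norm_num
    rw [h1, Real.sqrt_mul (by positivity), ← mul_assoc, ← hc, mul_pow]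
    have h2 : √((k : ℝ)⁻¹) ^ d ≤ (k : ℝ) ^ (-(5 / 2) : ℝ) := by
      calc √((k : ℝ)⁻¹) ^ d ≤ √((k : ℝ)⁻¹) ^ 5 :=
            pow_le_pow_of_le_one (Real.sqrt_nonneg _)
              (Real.sqrt_le_one.2 (inv_le_one_of_one_le₀ hk')) hd
        _ = _ := by
          rw [Real.sqrt_eq_rpow, ← Real.rpow_natCast, ← Real.rpow_mul (by positivity),
            Real.inv_rpow (by positivity), ← Real.rpow_neg (by positivity)]
          norm_num
    have h3 : (k : ℝ) ^ (-(5 / 2) : ℝ) ≤ 2 ^ (5 / 2 : ℝ) * ((k : ℝ) + 1) ^ (-(5 / 2) : ℝ) := by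
      rw [Real.rpow_neg (by positivity), Real.rpow_neg (by positivity), ← div_eq_mul_inv,
        le_div_iff₀ (by positivity), inv_mul_le_iff₀ (by positivity),
        ← Real.mul_rpow (by positivity) (by positivity)]
      exact Real.rpow_le_rpow (by positivity) (by linarith) (by norm_num)
    calc c ^ d * √((k : ℝ)⁻¹) ^ d
        ≤ c ^ d * (2 ^ (5 / 2 : ℝ) * ((k : ℝ) + 1) ^ (-(5 / 2) : ℝ)) := by
          gcongr; exact h2.trans h3
      _ ≤ _ := by
          rw [add_mul, one_mul, mul_assoc]
          exact le_add_of_nonneg_right (by positivity)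

/-! ### Green kernel and potential estimates -/

lemma lintegral_position [NeZero d] (f : (Fin d → ℤ) → ℝ≥0∞) (k : ℕ) :
    ∫⁻ ω, f (position k ω) ∂walkLaw d = ∑' x, f x * heat d k x := by
  have h1 : ∀ ω : ℕ → Step d, f (position k ω) =
      ∑' x, f x * (if position k ω = x then 1 else 0) := by
    intro ω
    rw [tsum_eq_single (position k ω)]
    · simp
    · intro x hx; simp [Ne.symm hx]
  simp_rw [h1]
  rw [lintegral_tsum]
  · refine tsum_congr fun x => ?_
    rw [heat_eq_lintegral, lintegral_const_mul]
    exact measurable_comp_position (fun y => if y = x then (1 : ℝ≥0∞) else 0) k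
  · exact fun x => (measurable_comp_position
      (fun y => f x * if y = x then (1 : ℝ≥0∞) else 0) k).aemeasurable

lemma tsum_heat [NeZero d] (k : ℕ) : ∑' x, heat d k x = 1 := by
  have := lintegral_position (d := d) (fun _ => 1) k
  simpa using this.symm

lemma green_eq [NeZero d] (x : Fin d → ℤ) : green d x = ∑' k, heat d k x := by
  have h1 : ∀ ω : ℕ → Step d, totalLocalTime x ω =
      ∑' k, (if position k ω = x then (1 : ℝ≥0∞) else 0) := by
    intro ω
    rw [totalLocalTime, ← ENNReal.tsum_set_one, tsum_subtype {k | position k ω = x} fun _ => 1]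
    refine tsum_congr fun k => ?_
    by_cases h : position k ω = x <;> simp [h]
  rw [green]
  simp_rw [h1]
  rw [lintegral_tsum]
  · simp_rw [heat_eq_lintegral]
  · exact fun k => (measurable_comp_position
      (fun y => if y = x then (1 : ℝ≥0∞) else 0) k).aemeasurable

lemma tsum_rpow_lt_top {p : ℝ} (hp : 1 < p) :
    ∑' k : ℕ, ENNReal.ofReal (((k : ℝ) + 1) ^ (-p)) ≠ ⊤ := by
  have h1 : Summable fun k : ℕ => ((k : ℝ) + 1) ^ (-p) := by
    have := (summable_nat_add_iff 1).2 (Real.summable_nat_rpow.2 (neg_lt_neg hp))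
    exact_mod_cast this
  rw [← ENNReal.ofReal_tsum_of_nonneg (fun k => by positivity) h1]
  exact ENNReal.ofReal_ne_top

/-- The bound of `exists_heat_le` with constant `C`. -/
def HeatBound (d : ℕ) (C : ℝ) : Prop := 0 < C ∧ ∀ (k : ℕ) (x : Fin d → ℤ),
    heat d k x ≤ ENNReal.ofReal (C * ((k : ℝ) + 1) ^ (-(5 / 2) : ℝ))

/-- Bound the factor with the larger time uniformly and sum the other to at most one: the result
`max(j,k)^(-5/2)` is at most the product of the two powers `-5/4`, each summable in its own index.
The map `τ` accommodates translations. -/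
lemma tsum_heat_mul_heat_le [NeZero d] {C : ℝ} (h : HeatBound d C) (j k : ℕ)
    {τ : (Fin d → ℤ) → Fin d → ℤ} (hτ : Function.Injective τ) :
    ∑' x, heat d j x * heat d k (τ x) ≤ ENNReal.ofReal C *
      (ENNReal.ofReal (((j : ℝ) + 1) ^ (-(5 / 4) : ℝ)) *
        ENNReal.ofReal (((k : ℝ) + 1) ^ (-(5 / 4) : ℝ))) := by
  have e : ∀ m : ℕ, ((m : ℝ) + 1) ^ (-(5 / 2) : ℝ) =
      ((m : ℝ) + 1) ^ (-(5 / 4) : ℝ) * ((m : ℝ) + 1) ^ (-(5 / 4) : ℝ) := fun m => by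
    rw [← Real.rpow_add (by positivity)]; norm_num
  have hC := h.1.le
  rw [← ENNReal.ofReal_mul (by positivity), ← ENNReal.ofReal_mul hC]
  rcases le_total j k with hjk | hjk
  · calc _ ≤ ∑' x, heat d j x * ENNReal.ofReal (C * ((k : ℝ) + 1) ^ (-(5 / 2) : ℝ)) := by
          gcongr; exact h.2 _ _
      _ = ENNReal.ofReal (C * ((k : ℝ) + 1) ^ (-(5 / 2) : ℝ)) := by
          rw [ENNReal.tsum_mul_right, tsum_heat, one_mul]
      _ ≤ _ := by
          rw [e]
          gcongr ENNReal.ofReal (C * (?_ * _))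
          exact Real.rpow_le_rpow_of_nonpos (by positivity) (by gcongr) (by norm_num)
  · calc _ ≤ ∑' x, ENNReal.ofReal (C * ((j : ℝ) + 1) ^ (-(5 / 2) : ℝ)) * heat d k (τ x) := by
          gcongr; exact h.2 _ _
      _ ≤ ENNReal.ofReal (C * ((j : ℝ) + 1) ^ (-(5 / 2) : ℝ)) * 1 := by
          rw [ENNReal.tsum_mul_left]
          gcongr
          rw [← tsum_heat (d := d) k]
          exact ENNReal.tsum_comp_le_tsum_of_injective hτ _
      _ ≤ _ := by
          rw [e, mul_one]
          gcongr ENNReal.ofReal (C * (_ * ?_))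
          exact Real.rpow_le_rpow_of_nonpos (by positivity) (by gcongr) (by norm_num)

lemma tsum_green_sq_ne_top (hd : 5 ≤ d) : ∑' x, green d x ^ 2 ≠ ⊤ := by
  have : NeZero d := ⟨by omega⟩
  obtain ⟨C, h⟩ := exists_heat_le hd
  have h1 : ∑' x, green d x ^ 2 ≤ ENNReal.ofReal C *
      ((∑' k : ℕ, ENNReal.ofReal (((k : ℝ) + 1) ^ (-(5 / 4) : ℝ))) *
        ∑' k : ℕ, ENNReal.ofReal (((k : ℝ) + 1) ^ (-(5 / 4) : ℝ))) := by
    calc ∑' x, green d x ^ 2 = ∑' j, ∑' k, ∑' x, heat d j x * heat d k x := by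
          simp_rw [sq, green_eq, ← ENNReal.tsum_mul_right, ← ENNReal.tsum_mul_left]
          rw [ENNReal.tsum_comm]
          exact tsum_congr fun j => ENNReal.tsum_comm
      _ ≤ ∑' j : ℕ, ∑' k : ℕ, ENNReal.ofReal C * (ENNReal.ofReal (((j : ℝ) + 1) ^ (-(5 / 4) : ℝ)) *
          ENNReal.ofReal (((k : ℝ) + 1) ^ (-(5 / 4) : ℝ))) := by
          gcongr with j k
          exact tsum_heat_mul_heat_le (τ := id) h j k Function.injective_id
      _ = _ := by
          simp_rw [ENNReal.tsum_mul_left, ENNReal.tsum_mul_right]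
  refine ne_top_of_le_ne_top ?_ h1
  have := tsum_rpow_lt_top (p := 5 / 4) (by norm_num)
  exact ENNReal.mul_ne_top ENNReal.ofReal_ne_top (ENNReal.mul_ne_top this this)

/-- The expected number of visits at `x`, from time `r` on, of the walk started at `z`. -/
def tailGreen (d r : ℕ) (z x : Fin d → ℤ) : ℝ≥0∞ := ∑' k, heat d (k + r) (x - z)

lemma tailGreen_zero_zero [NeZero d] (x : Fin d → ℤ) : tailGreen d 0 0 x = green d x := by
  simp [tailGreen, green_eq]

lemma tailGreen_ne_top (hd : 5 ≤ d) (r : ℕ) (z x : Fin d → ℤ) : tailGreen d r z x ≠ ⊤ := by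
  have : NeZero d := ⟨by omega⟩
  have h1 : tailGreen d r z x ≤ green d (x - z) := by
    rw [green_eq, tailGreen]
    exact ENNReal.tsum_comp_le_tsum_of_injective (add_left_injective r) _
  refine ne_top_of_le_ne_top (fun h => tsum_green_sq_ne_top hd ?_) h1
  exact ENNReal.tsum_eq_top_of_eq_top ⟨x - z, by rw [h]; simp⟩

/-- Split the exponent as `5/4 = 1/8 + 9/8`: the part `9/8` keeps the series convergent and the part
`1/8` gives decay in `r`. Any positive power of `r` would be enough for the `Spread` estimate after
changing the parameters. -/
lemma exists_potential_tailGreen_le (hd : 5 ≤ d) : ∃ C : ℝ, 0 < C ∧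
    ∀ (r : ℕ) (z y : Fin d → ℤ), 0 < r →
      potential (tailGreen d r z) y ≤ ENNReal.ofReal (C * (r : ℝ) ^ (-(1 / 8) : ℝ)) := by
  have : NeZero d := ⟨by omega⟩
  obtain ⟨C, h⟩ := exists_heat_le hd
  have hK := tsum_rpow_lt_top (p := 5 / 4) (by norm_num)
  have hK' := tsum_rpow_lt_top (p := 9 / 8) (by norm_num)
  set K := ∑' k : ℕ, ENNReal.ofReal (((k : ℝ) + 1) ^ (-(5 / 4) : ℝ)) with hKd
  set K' := ∑' k : ℕ, ENNReal.ofReal (((k : ℝ) + 1) ^ (-(9 / 8) : ℝ)) with hKd'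
  have hC := h.1
  refine ⟨C * (K.toReal * K'.toReal) + 1, by positivity, fun r z y hr => ?_⟩
  have hr' : (0 : ℝ) < r := by exact_mod_cast hr
  have h1 : ∀ j, ∫⁻ ω, tailGreen d r z (y + position j ω) ∂walkLaw d =
      ∑' k, ∑' x, heat d j x * heat d (k + r) (y + x - z) := by
    intro j
    rw [lintegral_position (fun x => tailGreen d r z (y + x)), ENNReal.tsum_comm]
    simp_rw [tailGreen, ← ENNReal.tsum_mul_right, mul_comm]
  have h2 : ∀ k : ℕ, ENNReal.ofReal ((((k + r : ℕ) : ℝ) + 1) ^ (-(5 / 4) : ℝ)) ≤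
      ENNReal.ofReal ((r : ℝ) ^ (-(1 / 8) : ℝ)) *
        ENNReal.ofReal (((k : ℝ) + 1) ^ (-(9 / 8) : ℝ)) := by
    intro k
    rw [← ENNReal.ofReal_mul (by positivity)]
    refine ENNReal.ofReal_le_ofReal ?_
    have : (-(5 / 4) : ℝ) = -(1 / 8) + -(9 / 8) := by norm_num
    rw [this, Real.rpow_add (by positivity)]
    push_cast
    gcongr ?_ * ?_
    · exact Real.rpow_le_rpow_of_nonpos hr' (by linarith [Nat.cast_nonneg (α := ℝ) k])
        (by norm_num)
    · exact Real.rpow_le_rpow_of_nonpos (by positivity) (by linarith) (by norm_num)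
  calc potential (tailGreen d r z) y
      = ∑' j, ∑' k, ∑' x, heat d j x * heat d (k + r) (y + x - z) := by
        unfold potential; simp_rw [h1]
    _ ≤ ∑' j : ℕ, ∑' k : ℕ, ENNReal.ofReal C * (ENNReal.ofReal (((j : ℝ) + 1) ^ (-(5 / 4) : ℝ)) *
          (ENNReal.ofReal ((r : ℝ) ^ (-(1 / 8) : ℝ)) *
            ENNReal.ofReal (((k : ℝ) + 1) ^ (-(9 / 8) : ℝ)))) := by
        gcongr with j k
        refine (tsum_heat_mul_heat_le (τ := fun x => y + x - z) h j (k + r)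
          (fun a b hab => by simpa using hab)).trans ?_
        gcongr
        exact h2 k
    _ = ENNReal.ofReal C * (K * (ENNReal.ofReal ((r : ℝ) ^ (-(1 / 8) : ℝ)) * K')) := by
        simp_rw [ENNReal.tsum_mul_left, ENNReal.tsum_mul_right, ← hKd, ← hKd']
    _ = ENNReal.ofReal (C * (K.toReal * ((r : ℝ) ^ (-(1 / 8) : ℝ) * K'.toReal))) := by
        rw [ENNReal.ofReal_mul hC.le, ENNReal.ofReal_mul ENNReal.toReal_nonneg,
          ENNReal.ofReal_mul (by positivity), ENNReal.ofReal_toReal hK, ENNReal.ofReal_toReal hK']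
    _ ≤ _ := by
        refine ENNReal.ofReal_le_ofReal ?_
        have : 0 ≤ (r : ℝ) ^ (-(1 / 8) : ℝ) := by positivity
        nlinarith

/-- The potential of a finite set is at most a power of its size. -/
lemma exists_potential_indicator_le (hd : 5 ≤ d) : ∃ C : ℝ, 0 < C ∧
    ∀ (Λ : Finset (Fin d → ℤ)) (z : Fin d → ℤ), Λ.Nonempty →
      potential (fun x => ENNReal.ofReal (if x ∈ Λ then 1 else 0)) z ≤
        ENNReal.ofReal (C * (Λ.card : ℝ) ^ (4 / 9 : ℝ)) := by
  have : NeZero d := ⟨by omega⟩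
  obtain ⟨C, h⟩ := exists_heat_le hd
  have hK := tsum_rpow_lt_top (p := 5 / 4) (by norm_num)
  set K := ∑' k : ℕ, ENNReal.ofReal (((k : ℝ) + 1) ^ (-(5 / 4) : ℝ)) with hKd
  have hC := h.1
  refine ⟨2 + C * K.toReal, by positivity, fun Λ z hΛ => ?_⟩
  set L : ℝ := (Λ.card : ℝ) with hL
  have hL1 : 1 ≤ L := by rw [hL]; exact_mod_cast hΛ.card_pos
  set f : (Fin d → ℤ) → ℝ≥0∞ := fun x => ENNReal.ofReal (if x ∈ Λ then 1 else 0) with hf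
  have hf1 : ∀ k, ∫⁻ ω, f (z + position k ω) ∂walkLaw d ≤ 1 := by
    intro k
    calc _ ≤ ∫⁻ _, 1 ∂walkLaw d := by
          refine lintegral_mono fun ω => ?_
          simp only [hf]
          split_ifs <;> simp
      _ = 1 := by simp
  have hf2 : ∀ k : ℕ, ∫⁻ ω, f (z + position k ω) ∂walkLaw d ≤
      ENNReal.ofReal L * ENNReal.ofReal (C * ((k : ℝ) + 1) ^ (-(5 / 2) : ℝ)) := by
    intro k
    have h3 : ∀ x, f (z + x) = ∑ y ∈ Λ, if x = y - z then 1 else 0 := by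
      intro x
      simp only [hf]
      simp_rw [eq_sub_iff_add_eq', Finset.sum_ite_eq]
      split_ifs <;> simp
    simp_rw [h3]
    rw [lintegral_finsetSum]
    · simp_rw [← heat_eq_lintegral]
      refine (Finset.sum_le_sum fun y _ => h.2 k _).trans ?_
      rw [Finset.sum_const, nsmul_eq_mul, hL, ENNReal.ofReal_natCast]
    · exact fun y _ => measurable_comp_position (fun x => if x = y - z then (1 : ℝ≥0∞) else 0) k
  -- The first `r` steps contribute at most `r`, the rest at most a constant times `L r^(-5/4)`;
  -- these balance at `r = L^(4/9)`. What matters later is that `4/9 < 1/2`.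
  set r : ℕ := ⌈L ^ (4 / 9 : ℝ)⌉₊ with hr
  have hq1 : 1 ≤ L ^ (4 / 9 : ℝ) := Real.one_le_rpow hL1 (by norm_num)
  have hr1 : L ^ (4 / 9 : ℝ) ≤ r := Nat.le_ceil _
  have hr0 : (0 : ℝ) < r := by linarith
  have hr2 : (r : ℝ) ≤ 2 * L ^ (4 / 9 : ℝ) := by
    have := Nat.ceil_lt_add_one (a := L ^ (4 / 9 : ℝ)) (by positivity)
    linarith
  have hr3 : (r : ℝ) ^ (-(5 / 4) : ℝ) * L ≤ L ^ (4 / 9 : ℝ) := by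
    calc (r : ℝ) ^ (-(5 / 4) : ℝ) * L ≤ (L ^ (4 / 9 : ℝ)) ^ (-(5 / 4) : ℝ) * L := by
          gcongr ?_ * L
          exact Real.rpow_le_rpow_of_nonpos (by positivity) hr1 (by norm_num)
      _ = L ^ (4 / 9 : ℝ) := by
          rw [← Real.rpow_mul (by positivity)]
          conv_lhs => rw [← Real.rpow_one L]
          rw [← Real.rpow_mul (by positivity), ← Real.rpow_add (by positivity)]
          norm_num
  have h4 : ∀ k : ℕ, ENNReal.ofReal (C * (((k + r : ℕ) : ℝ) + 1) ^ (-(5 / 2) : ℝ)) ≤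
      ENNReal.ofReal (C * (r : ℝ) ^ (-(5 / 4) : ℝ)) *
        ENNReal.ofReal (((k : ℝ) + 1) ^ (-(5 / 4) : ℝ)) := by
    intro k
    rw [← ENNReal.ofReal_mul (by positivity)]
    refine ENNReal.ofReal_le_ofReal ?_
    have : (-(5 / 2) : ℝ) = -(5 / 4) + -(5 / 4) := by norm_num
    rw [this, Real.rpow_add (by positivity), mul_assoc]
    push_cast
    gcongr C * (?_ * ?_)
    · exact Real.rpow_le_rpow_of_nonpos hr0 (by linarith [Nat.cast_nonneg (α := ℝ) k])
        (by norm_num)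
    · exact Real.rpow_le_rpow_of_nonpos (by positivity) (by linarith) (by norm_num)
  calc potential f z
      = ∑ k ∈ Finset.range r, ∫⁻ ω, f (z + position k ω) ∂walkLaw d +
        ∑' k, ∫⁻ ω, f (z + position (k + r) ω) ∂walkLaw d :=
        (ENNReal.summable.sum_add_tsum_nat_add' (k := r)).symm
    _ ≤ ∑ k ∈ Finset.range r, 1 + ∑' k : ℕ, ENNReal.ofReal L *
        (ENNReal.ofReal (C * (r : ℝ) ^ (-(5 / 4) : ℝ)) *
        ENNReal.ofReal (((k : ℝ) + 1) ^ (-(5 / 4) : ℝ))) := by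
        gcongr with k _ k
        · exact hf1 k
        · refine (hf2 _).trans ?_
          gcongr
          exact h4 k
    _ = ENNReal.ofReal r + ENNReal.ofReal L *
        (ENNReal.ofReal (C * (r : ℝ) ^ (-(5 / 4) : ℝ)) * K) := by
        rw [ENNReal.tsum_mul_left, ENNReal.tsum_mul_left, ← hKd]
        simp
    _ = ENNReal.ofReal (r + L * ((C * (r : ℝ) ^ (-(5 / 4) : ℝ)) * K.toReal)) := by
        rw [ENNReal.ofReal_add (by positivity) (by positivity),
          ENNReal.ofReal_mul (p := L) (by positivity),
          ENNReal.ofReal_mul (q := K.toReal) (by positivity), ENNReal.ofReal_toReal hK]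
    _ ≤ _ := by
        refine ENNReal.ofReal_le_ofReal ?_
        have : 0 ≤ C * K.toReal := by positivity
        nlinarith

/-- The potential of a truncated counting function. -/
lemma potential_le_of_count [NeZero d] {ι : Type*} (I : Finset ι) (p : ι → Fin d → ℤ)
    {f : (Fin d → ℤ) → ℝ≥0∞} {T : ℝ≥0∞} (hT : ∀ x, f x ≤ T)
    (hf : ∀ x, f x ≤ ∑ i ∈ I, if x = p i then 1 else 0) (r : ℕ) (z : Fin d → ℤ) :
    potential f z ≤ r * T + ∑ i ∈ I, tailGreen d r z (p i) := by
  calc potential f z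
      = ∑ k ∈ Finset.range r, ∫⁻ ω, f (z + position k ω) ∂walkLaw d +
        ∑' k, ∫⁻ ω, f (z + position (k + r) ω) ∂walkLaw d :=
        (ENNReal.summable.sum_add_tsum_nat_add' (k := r)).symm
    -- The truncation level controls the first `r` steps; the untruncated count is used from time
    -- `r` on, where the heat kernel is small.
    _ ≤ ∑ k ∈ Finset.range r, T + ∑' k, ∑ i ∈ I, heat d (k + r) (p i - z) := by
        gcongr with k _ k
        · refine (lintegral_mono fun ω => hT _).trans (by simp)
        · refine (lintegral_mono fun ω => hf _).trans ?_
          rw [lintegral_finsetSum]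
          · simp_rw [heat_eq_lintegral, eq_sub_iff_add_eq']
            exact le_rfl
          · exact fun i _ => measurable_comp_position
              (fun x => if z + x = p i then (1 : ℝ≥0∞) else 0) _
    _ = _ := by
        rw [Summable.tsum_finsetSum fun i _ => ENNReal.summable]
        simp [tailGreen]

/-- Summed over all times, `P(S_i = x) G_d(x)` gives `G_d(x)²`. This is the mean intersection of two
independent walks. -/
lemma sum_lintegral_green_le [NeZero d] (I : Finset ℕ) :
    ∑ i ∈ I, ∫⁻ ω, green d (position i ω) ∂walkLaw d ≤ ∑' x, green d x ^ 2 := by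
  simp_rw [lintegral_position]
  refine (ENNReal.sum_le_tsum I).trans ?_
  rw [ENNReal.tsum_comm]
  simp_rw [ENNReal.tsum_mul_left, ← green_eq, sq]
  exact le_rfl

/-! ### Dyadic decomposition of pairs of times -/

/-- Two different times are separated by the midpoint of a dyadic block containing both. -/
lemma exists_dyadic_split {l₀ i j : ℕ} (hij : i < j) (h : i / 2 ^ l₀ ≠ j / 2 ^ l₀) :
    ∃ l k, l₀ ≤ l ∧ 2 * k * 2 ^ l ≤ i ∧ i < (2 * k + 1) * 2 ^ l ∧ (2 * k + 1) * 2 ^ l ≤ j ∧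
      j < (2 * k + 2) * 2 ^ l := by
  classical
  have hex : ∃ l, i / 2 ^ l = j / 2 ^ l := by
    refine ⟨j, ?_⟩
    have h1 : j < 2 ^ j := Nat.lt_two_pow_self
    rw [Nat.div_eq_of_lt h1, Nat.div_eq_of_lt (hij.trans h1)]
  have hstep : ∀ l, i / 2 ^ l = j / 2 ^ l → ∀ m, i / 2 ^ (l + m) = j / 2 ^ (l + m) := by
    intro l hl m
    rw [pow_add, ← Nat.div_div_eq_div_mul, ← Nat.div_div_eq_div_mul, hl]
  -- At the least level where the two times share a block, the block indices one level lower are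
  -- `2q` and `2q + 1`, so the midpoint of the common block separates them.
  have hfind := Nat.find_spec hex
  have hgt : l₀ < Nat.find hex := by
    by_contra hcon
    obtain ⟨m, hm⟩ := Nat.exists_eq_add_of_le (not_lt.1 hcon)
    exact h (hm ▸ hstep _ hfind m)
  obtain ⟨l, hl⟩ : ∃ l, Nat.find hex = l + 1 := ⟨Nat.find hex - 1, by omega⟩
  have hne : i / 2 ^ l ≠ j / 2 ^ l := Nat.find_min hex (by omega)
  rw [hl, pow_succ, ← Nat.div_div_eq_div_mul, ← Nat.div_div_eq_div_mul] at hfind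
  have hle : i / 2 ^ l ≤ j / 2 ^ l := Nat.div_le_div_right hij.le
  have hp : 0 < 2 ^ l := by positivity
  set q := i / 2 ^ l / 2 with hq
  have hi : i / 2 ^ l = 2 * q := by omega
  have hj : j / 2 ^ l = 2 * q + 1 := by omega
  have hi1 := (Nat.div_eq_iff hp).1 hi
  have hj1 := (Nat.div_eq_iff hp).1 hj
  have e1 : (2 * q + 1) * 2 ^ l = 2 * q * 2 ^ l + 2 ^ l := by ring
  have e2 : (2 * q + 2) * 2 ^ l = (2 * q + 1) * 2 ^ l + 2 ^ l := by ring
  exact ⟨l, q, by omega, by omega, by omega, by omega, by omega⟩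

lemma card_sq_le (s : Finset ℕ) :
    s.card ^ 2 ≤ s.card + 2 * ((s ×ˢ s).filter fun p => p.1 < p.2).card := by
  classical
  have h1 : s ×ˢ s ⊆ s.diag ∪ ((s ×ˢ s).filter (fun p => p.1 < p.2) ∪
      ((s ×ˢ s).filter fun p => p.1 < p.2).image Prod.swap) := by
    rintro ⟨i, j⟩ hp
    rw [Finset.mem_product] at hp
    simp only [Finset.mem_union, Finset.mem_diag, Finset.mem_filter, Finset.mem_product,
      Finset.mem_image, Prod.exists]
    rcases lt_trichotomy i j with h | h | h
    · exact Or.inr (Or.inl ⟨hp, h⟩)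
    · exact Or.inl ⟨hp.1, h⟩
    · exact Or.inr (Or.inr ⟨j, i, ⟨hp.symm, h⟩, rfl⟩)
  have h2 := Finset.card_le_card h1
  rw [Finset.card_product, ← sq] at h2
  refine h2.trans ((Finset.card_union_le _ _).trans ?_)
  rw [Finset.diag_card, two_mul]
  gcongr
  exact (Finset.card_union_le _ _).trans (add_le_add le_rfl Finset.card_image_le)

/-- Ordered pairs of times in `s` that lie in different blocks of length `b`. -/
def farPairs (b : ℕ) (s : Finset ℕ) : Finset (ℕ × ℕ) :=
  (s ×ˢ s).filter fun p => p.1 < p.2 ∧ p.1 / b ≠ p.2 / b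

lemma card_sq_le_farPairs {b : ℕ} (hb : 0 < b) (s : Finset ℕ) :
    s.card ^ 2 ≤ (2 * b - 1) * s.card + 2 * (farPairs b s).card := by
  classical
  -- A pair inside one block is determined by its first time and a gap in `1, …, b - 1`.
  have h1 : (s ×ˢ s).filter (fun p => p.1 < p.2) ⊆
      (s ×ˢ Finset.Ico 1 b).image (fun p => (p.1, p.1 + p.2)) ∪ farPairs b s := by
    rintro ⟨i, j⟩ hp
    simp only [Finset.mem_filter, Finset.mem_product] at hp
    by_cases hd : i / b = j / b
    · refine Finset.mem_union_left _ (Finset.mem_image.2 ⟨(i, j - i), ?_, ?_⟩)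
      · simp only [Finset.mem_product, Finset.mem_Ico]
        refine ⟨hp.1.1, by omega, ?_⟩
        have h3 := Nat.div_add_mod i b
        have h4 := Nat.div_add_mod j b
        have h5 := Nat.mod_lt j hb
        rw [hd] at h3
        omega
      · simp only [Prod.mk.injEq, true_and]; omega
    · exact Finset.mem_union_right _ (by simp [farPairs, hp, hd])
  have h2 : ((s ×ˢ s).filter fun p => p.1 < p.2).card ≤ s.card * (b - 1) + (farPairs b s).card := by
    refine (Finset.card_le_card h1).trans ((Finset.card_union_le _ _).trans ?_)
    gcongr
    refine Finset.card_image_le.trans ?_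
    simp
  have h3 := card_sq_le s
  obtain ⟨c, rfl⟩ : ∃ c, b = c + 1 := ⟨b - 1, by omega⟩
  have e : 2 * (c + 1) - 1 = 2 * c + 1 := by omega
  rw [e]
  simp only [Nat.add_sub_cancel] at h2
  nlinarith

/-- Visits of `x` during the times `1, …, L`. -/
def pastCount (L : ℕ) (u : ℕ → Step d) (x : Fin d → ℤ) : ℕ :=
  ((Finset.Icc 1 L).filter fun k => position k u = x).card

/-- The truncated intersection local time of two walks. -/
def crossSum (L : ℕ) (T : ℝ) (u v : ℕ → Step d) : ℝ :=
  ∑ k ∈ Finset.range L, min (pastCount L u (position k v) : ℝ) T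

/-- The truncated intersections of the two halves of a dyadic block of length `2 ^ (l + 1)`. -/
def dyadicCross (T : ℝ) (l k : ℕ) (ω : ℕ → Step d) : ℝ :=
  crossSum (2 ^ l) T (rev ((2 * k + 1) * 2 ^ l) ω) (future ((2 * k + 1) * 2 ^ l) ω)

/-- The times in `s` spent at `x`. -/
def visitTimes (s : Finset ℕ) (ω : ℕ → Step d) (x : Fin d → ℤ) : Finset ℕ :=
  s.filter fun i => position i ω = x

lemma card_visitTimes_eq (n : ℕ) (ω : ℕ → Step d) (x : Fin d → ℤ) :
    (visitTimes (Finset.range (n + 1)) ω x).card = localTime n x ω := rfl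

/-- Time `m - k` becomes time `k` of the reversed walk seen from `S_m`. The past runs over `k = 1,
…, L`, so that time `m` itself belongs to the future only. -/
lemma card_visitTimes_le_pastCount {L m : ℕ} (hL : L ≤ m) (ω : ℕ → Step d) (x : Fin d → ℤ) :
    (visitTimes (Finset.Ico (m - L) m) ω x).card ≤ pastCount L (rev m ω) (x - position m ω) := by
  refine Finset.card_le_card_of_injOn (fun i => m - i) ?_ ?_
  · intro i hi
    simp only [visitTimes, Finset.coe_filter, Finset.mem_Ico, Set.mem_ofPred_eq,
      Finset.mem_Icc] at hi ⊢
    refine ⟨by omega, ?_⟩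
    have := position_rev (m := m) (k := m - i) (by omega) ω
    rw [show m - (m - i) = i by omega, hi.2] at this
    rw [this]; abel
  · intro i hi j hj hij
    simp only [visitTimes, Finset.coe_filter, Finset.mem_Ico, Set.mem_ofPred_eq] at hi hj hij
    omega

/-- Each future visit to `x` collects the number of past visits to `x`. On `F` this number is at
most `T`, so truncating the charge loses nothing. -/
lemma sum_card_mul_card_le {L m : ℕ} (hL : L ≤ m) {T : ℝ} (hT : 0 ≤ T) (ω : ℕ → Step d)
    (F : Finset (Fin d → ℤ))
    (hF : ∀ x ∈ F, ((visitTimes (Finset.Ico (m - L) m) ω x).card : ℝ) ≤ T) :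
    ∑ x ∈ F, ((visitTimes (Finset.Ico (m - L) m) ω x).card : ℝ) *
      (visitTimes (Finset.Ico m (m + L)) ω x).card ≤ crossSum L T (rev m ω) (future m ω) := by
  classical
  have h1 : ∀ x ∈ F, ((visitTimes (Finset.Ico (m - L) m) ω x).card : ℝ) *
      (visitTimes (Finset.Ico m (m + L)) ω x).card ≤
      ∑ k ∈ Finset.range L with position (m + k) ω = x,
        min (pastCount L (rev m ω) (position k (future m ω)) : ℝ) T := by
    intro x hx
    have h2 : (visitTimes (Finset.Ico m (m + L)) ω x).card ≤
        ((Finset.range L).filter fun k => position (m + k) ω = x).card := by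
      refine Finset.card_le_card_of_injOn (fun i => i - m) ?_ ?_
      · intro i hi
        simp only [visitTimes, Finset.coe_filter, Finset.mem_Ico, Set.mem_ofPred_eq,
          Finset.mem_range] at hi ⊢
        refine ⟨by omega, ?_⟩
        rw [show m + (i - m) = i by omega, hi.2]
      · intro i hi j hj hij
        simp only [visitTimes, Finset.coe_filter, Finset.mem_Ico, Set.mem_ofPred_eq] at hi hj hij
        omega
    have h3 : ∀ k ∈ (Finset.range L).filter (fun k => position (m + k) ω = x),
        ((visitTimes (Finset.Ico (m - L) m) ω x).card : ℝ) ≤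
        min (pastCount L (rev m ω) (position k (future m ω)) : ℝ) T := by
      intro k hk
      have h4 := (Finset.mem_filter.1 hk).2
      rw [position_add] at h4
      refine le_min ?_ (hF x hx)
      have h5 := card_visitTimes_le_pastCount hL ω x
      rw [← h4, add_sub_cancel_left, h4] at h5
      exact_mod_cast h5
    calc _ ≤ (((Finset.range L).filter fun k => position (m + k) ω = x).card : ℝ) *
          ((visitTimes (Finset.Ico (m - L) m) ω x).card : ℝ) := by
          rw [mul_comm]; gcongr
      _ ≤ _ := by
          rw [← nsmul_eq_mul]
          exact Finset.card_nsmul_le_sum _ _ _ h3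
  refine (Finset.sum_le_sum h1).trans ?_
  refine Finset.sum_fiberwise_le_sum_of_sum_fiber_nonneg fun x _ => ?_
  exact Finset.sum_nonneg fun k _ => le_min (Nat.cast_nonneg _) hT

/-- The number of dyadic blocks at level `l` whose midpoint is at most `n`. -/
def numBlocks (n l : ℕ) : ℕ := (n / 2 ^ l + 1) / 2

lemma numBlocks_le (n l : ℕ) : (numBlocks n l : ℝ) ≤ n / 2 ^ (l + 1) + 1 / 2 := by
  have h1 : 2 * numBlocks n l ≤ n / 2 ^ l + 1 := by unfold numBlocks; omega
  have h2 : (2 * numBlocks n l : ℝ) ≤ ((n / 2 ^ l : ℕ) : ℝ) + 1 := by exact_mod_cast h1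
  have h3 : ((n / 2 ^ l : ℕ) : ℝ) ≤ n / 2 ^ l := by
    have := Nat.cast_div_le (α := ℝ) (m := n) (n := 2 ^ l)
    simpa using this
  rw [pow_succ, ← div_div]
  linarith

lemma midpoint_le {n l k : ℕ} (hk : k < numBlocks n l) : (2 * k + 1) * 2 ^ l ≤ n := by
  have h1 : 2 * k + 1 ≤ n / 2 ^ l := by unfold numBlocks at hk; omega
  exact (Nat.le_div_iff_mul_le (by positivity)).1 h1

lemma card_farPairs_le (n l₀ : ℕ) (ω : ℕ → Step d) (x : Fin d → ℤ) :
    (farPairs (2 ^ l₀) (visitTimes (Finset.range (n + 1)) ω x)).card ≤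
      ∑ l ∈ Finset.Ico l₀ (Nat.log 2 n + 1), ∑ k ∈ Finset.range (numBlocks n l),
        (visitTimes (Finset.Ico ((2 * k + 1) * 2 ^ l - 2 ^ l) ((2 * k + 1) * 2 ^ l)) ω x).card *
        (visitTimes (Finset.Ico ((2 * k + 1) * 2 ^ l) ((2 * k + 1) * 2 ^ l + 2 ^ l)) ω x).card := by
  classical
  simp_rw [← Finset.card_product]
  have h1 : farPairs (2 ^ l₀) (visitTimes (Finset.range (n + 1)) ω x) ⊆
      (Finset.Ico l₀ (Nat.log 2 n + 1)).biUnion fun l => (Finset.range (numBlocks n l)).biUnion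
        fun k => visitTimes (Finset.Ico ((2 * k + 1) * 2 ^ l - 2 ^ l) ((2 * k + 1) * 2 ^ l)) ω x ×ˢ
        visitTimes (Finset.Ico ((2 * k + 1) * 2 ^ l) ((2 * k + 1) * 2 ^ l + 2 ^ l)) ω x := by
    rintro ⟨i, j⟩ hp
    simp only [farPairs, visitTimes, Finset.mem_filter, Finset.mem_product, Finset.mem_range] at hp
    obtain ⟨⟨⟨hi, hxi⟩, hj, hxj⟩, hij, hne⟩ := hp
    obtain ⟨l, k, hl, h2, h3, h4, h5⟩ := exists_dyadic_split hij hne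
    have hn : n ≠ 0 := by omega
    have e1 : (2 * k + 1) * 2 ^ l = 2 * k * 2 ^ l + 2 ^ l := by ring
    have e2 : (2 * k + 2) * 2 ^ l = (2 * k + 1) * 2 ^ l + 2 ^ l := by ring
    simp only [Finset.mem_biUnion, Finset.mem_Ico, Finset.mem_range, Finset.mem_product, visitTimes,
      Finset.mem_filter]
    refine ⟨l, ⟨hl, ?_⟩, k, ?_, ⟨⟨by omega, by omega⟩, hxi⟩, ⟨by omega, by omega⟩, hxj⟩
    · have : 2 ^ l ≤ n := by nlinarith
      exact Nat.lt_succ_of_le (Nat.le_log_of_pow_le (by norm_num) this)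
    · have : 2 * k + 1 ≤ n / 2 ^ l := (Nat.le_div_iff_mul_le (by positivity)).2 (by omega)
      unfold numBlocks
      omega
  refine (Finset.card_le_card h1).trans (Finset.card_biUnion_le.trans ?_)
  exact Finset.sum_le_sum fun l _ => Finset.card_biUnion_le

/-- Le Gall's decomposition: intersections over different blocks of length `2 ^ l₀` are counted by
the intersections of the two halves of larger dyadic blocks. -/
lemma sum_card_farPairs_le (n l₀ : ℕ) {T : ℝ} (hT : 0 ≤ T) (ω : ℕ → Step d)
    (F : Finset (Fin d → ℤ)) (hF : ∀ x ∈ F, (localTime n x ω : ℝ) ≤ T) :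
    ∑ x ∈ F, ((farPairs (2 ^ l₀) (visitTimes (Finset.range (n + 1)) ω x)).card : ℝ) ≤
      ∑ l ∈ Finset.Ico l₀ (Nat.log 2 n + 1), ∑ k ∈ Finset.range (numBlocks n l),
        dyadicCross T l k ω := by
  have h1 : ∀ x ∈ F, ((farPairs (2 ^ l₀) (visitTimes (Finset.range (n + 1)) ω x)).card : ℝ) ≤
      ∑ l ∈ Finset.Ico l₀ (Nat.log 2 n + 1), ∑ k ∈ Finset.range (numBlocks n l),
        ((visitTimes (Finset.Ico ((2 * k + 1) * 2 ^ l - 2 ^ l) ((2 * k + 1) * 2 ^ l)) ω x).card : ℝ)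
        * (visitTimes (Finset.Ico ((2 * k + 1) * 2 ^ l) ((2 * k + 1) * 2 ^ l + 2 ^ l)) ω x).card :=
    fun x _ => by exact_mod_cast card_farPairs_le n l₀ ω x
  refine (Finset.sum_le_sum h1).trans ?_
  rw [Finset.sum_comm]
  refine Finset.sum_le_sum fun l _ => ?_
  rw [Finset.sum_comm]
  refine Finset.sum_le_sum fun k hk => ?_
  have hm := midpoint_le (Finset.mem_range.1 hk)
  refine sum_card_mul_card_le (by nlinarith [Nat.zero_le (2 * k * 2 ^ l)]) hT ω F fun x hx => ?_
  refine le_trans ?_ (hF x hx)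
  rw [← card_visitTimes_eq]
  have : (visitTimes (Finset.Ico ((2 * k + 1) * 2 ^ l - 2 ^ l) ((2 * k + 1) * 2 ^ l)) ω x).card ≤
      (visitTimes (Finset.range (n + 1)) ω x).card := by
    refine Finset.card_le_card (Finset.filter_subset_filter _ fun i hi => ?_)
    rw [Finset.mem_Ico] at hi
    rw [Finset.mem_range]
    omega
  exact_mod_cast this

/-! ### Sums of squared local times and pairs of times -/

/-- The sites visited up to time `n`. -/
def visited (n : ℕ) (ω : ℕ → Step d) : Finset (Fin d → ℤ) :=
  (Finset.range (n + 1)).image fun k => position k ω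

lemma localTime_eq_zero {n : ℕ} {ω : ℕ → Step d} {x : Fin d → ℤ} (h : x ∉ visited n ω) :
    localTime n x ω = 0 := by
  rw [localTime, Finset.card_eq_zero, Finset.filter_eq_empty_iff]
  intro k hk hx
  exact h (Finset.mem_image.2 ⟨k, hk, hx⟩)

lemma sum_localTime (n : ℕ) (ω : ℕ → Step d) : ∑ x ∈ visited n ω, localTime n x ω = n + 1 := by
  have := Finset.card_eq_sum_card_fiberwise (f := fun k => position k ω)
    (s := Finset.range (n + 1)) (t := visited n ω)
    (fun k hk => Finset.mem_coe.2 (Finset.mem_image_of_mem _ hk))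
  rw [Finset.card_range] at this
  exact this.symm

lemma tsum_subtype_localTime_sq (n : ℕ) (ω : ℕ → Step d) (p : (Fin d → ℤ) → Prop)
    [DecidablePred p] : ∑' x : {x // p x}, (localTime n x.1 ω : ℝ) ^ 2 =
      ∑ x ∈ (visited n ω).filter p, (localTime n x ω : ℝ) ^ 2 := by
  refine (tsum_subtype {x | p x} fun x => (localTime n x ω : ℝ) ^ 2).trans ?_
  rw [Finset.sum_filter, tsum_eq_sum (s := visited n ω)]
  · refine Finset.sum_congr rfl fun x _ => ?_
    by_cases h : p x <;> simp [h]
  · intro x hx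
    simp [Set.indicator, localTime_eq_zero hx]

lemma lowSum_eq (n : ℕ) (t : ℝ) (ω : ℕ → Step d) :
    lowSum n t ω = ∑ x ∈ (visited n ω).filter (fun x => (localTime n x ω : ℝ) ≤ t),
      (localTime n x ω : ℝ) ^ 2 := by
  classical
  exact tsum_subtype_localTime_sq n ω _

lemma highSum_eq (n : ℕ) (t : ℝ) (ω : ℕ → Step d) :
    highSum n t ω = ∑ x ∈ (visited n ω).filter (fun x => t < (localTime n x ω : ℝ)),
      (localTime n x ω : ℝ) ^ 2 := by
  classical
  exact tsum_subtype_localTime_sq n ω _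

lemma localTime_sq_le {b : ℕ} (hb : 0 < b) (n : ℕ) (ω : ℕ → Step d) (x : Fin d → ℤ) :
    (localTime n x ω : ℝ) ^ 2 ≤ (2 * b - 1) * localTime n x ω +
      2 * (farPairs b (visitTimes (Finset.range (n + 1)) ω x)).card := by
  have h := card_sq_le_farPairs hb (visitTimes (Finset.range (n + 1)) ω x)
  rw [card_visitTimes_eq] at h
  have h2 : ((2 * b - 1 : ℕ) : ℝ) = 2 * b - 1 := by
    rw [Nat.cast_sub (by omega)]; push_cast; ring
  rw [← h2]
  exact_mod_cast h

/-- With blocks of length one every pair is far, and the diagonal contributes at most `∑ l_n(x) = n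
+ 1`. -/
lemma lowSum_le (n : ℕ) {T : ℝ} (hT : 0 ≤ T) (ω : ℕ → Step d) :
    lowSum n T ω ≤ n + 1 + 2 * ∑ l ∈ Finset.Ico 0 (Nat.log 2 n + 1),
      ∑ k ∈ Finset.range (numBlocks n l), dyadicCross T l k ω := by
  rw [lowSum_eq]
  set F := (visited n ω).filter fun x => (localTime n x ω : ℝ) ≤ T
  have h1 := sum_card_farPairs_le n 0 hT ω F fun x hx => (Finset.mem_filter.1 hx).2
  have h2 : ∑ x ∈ F, (localTime n x ω : ℝ) ≤ n + 1 := by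
    calc ∑ x ∈ F, (localTime n x ω : ℝ) ≤ ∑ x ∈ visited n ω, (localTime n x ω : ℝ) :=
          Finset.sum_le_sum_of_subset_of_nonneg (Finset.filter_subset _ _) fun _ _ _ => by positivity
      _ = n + 1 := by exact_mod_cast sum_localTime n ω
  calc _ ≤ ∑ x ∈ F, ((localTime n x ω : ℝ) +
        2 * (farPairs (2 ^ 0) (visitTimes (Finset.range (n + 1)) ω x)).card) := by
        refine Finset.sum_le_sum fun x _ => (localTime_sq_le (b := 2 ^ 0) (by simp) n ω x).trans ?_
        norm_num
    _ ≤ _ := by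
        rw [Finset.sum_add_distrib, ← Finset.mul_sum]
        linarith

/-- Once a local time exceeds four times the block length, pairs inside blocks and the diagonal
account for at most half of its square. Thus far pairs alone control these sites, and raising `l₀`
makes their mean small. -/
lemma midSum_le (n l₀ : ℕ) {M T : ℝ} (hT : 0 ≤ T) (hM : 4 * 2 ^ l₀ ≤ M) (ω : ℕ → Step d) :
    ∑ x ∈ (visited n ω).filter (fun x => M < (localTime n x ω : ℝ) ∧ (localTime n x ω : ℝ) ≤ T),
      (localTime n x ω : ℝ) ^ 2 ≤ 4 * ∑ l ∈ Finset.Ico l₀ (Nat.log 2 n + 1),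
      ∑ k ∈ Finset.range (numBlocks n l), dyadicCross T l k ω := by
  set F := (visited n ω).filter
    fun x => M < (localTime n x ω : ℝ) ∧ (localTime n x ω : ℝ) ≤ T
  have h1 := sum_card_farPairs_le n l₀ hT ω F fun x hx => (Finset.mem_filter.1 hx).2.2
  have h2 : ∀ x ∈ F, (localTime n x ω : ℝ) ^ 2 ≤
      4 * (farPairs (2 ^ l₀) (visitTimes (Finset.range (n + 1)) ω x)).card := by
    intro x hx
    have h3 := localTime_sq_le (b := 2 ^ l₀) (by positivity) n ω x
    have h4 := (Finset.mem_filter.1 hx).2.1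
    have h5 : (0 : ℝ) ≤ localTime n x ω := Nat.cast_nonneg _
    push_cast at h3
    nlinarith
  refine (Finset.sum_le_sum h2).trans ?_
  rw [← Finset.mul_sum]
  linarith

/-! ### Exponential moments of truncated intersections -/

/-- The truncated number of visits, as a potential-theoretic charge. -/
def pastCharge (L : ℕ) (T : ℝ) (u : ℕ → Step d) (x : Fin d → ℤ) : ℝ :=
  min (pastCount L u x : ℝ) T

/-- The potential of the truncated past is at most `s` on the past. -/
def Spread (L : ℕ) (T s : ℝ) (u : ℕ → Step d) : Prop :=
  ∀ z, pastCount L u z ≠ 0 →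
    potential (fun x => ENNReal.ofReal (pastCharge L T u x)) z ≤ ENNReal.ofReal s

open Classical in
/-- The exponential weight of the intersections with a spread-out past. -/
def crossWeight (L : ℕ) (T s lam : ℝ) (u v : ℕ → Step d) : ℝ≥0∞ :=
  if Spread L T s u then ENNReal.ofReal (Real.exp (lam * crossSum L T u v)) else 0

lemma pastCount_congr {L : ℕ} {u v : ℕ → Step d} (h : ∀ i < L, u i = v i) :
    pastCount L u = pastCount L v := by
  funext x
  unfold pastCount
  congr 1
  refine Finset.filter_congr fun k hk => ?_
  rw [position_congr fun i hi => h i (by have := Finset.mem_Icc.1 hk; omega)]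

lemma spread_congr {L : ℕ} {T s : ℝ} {u v : ℕ → Step d} (h : ∀ i < L, u i = v i) :
    Spread L T s u ↔ Spread L T s v := by
  unfold Spread pastCharge
  rw [pastCount_congr h]

lemma crossSum_congr {L : ℕ} {T : ℝ} {u v u' v' : ℕ → Step d} (hu : ∀ i < L, u i = u' i)
    (hv : ∀ i < L, v i = v' i) : crossSum L T u v = crossSum L T u' v' := by
  unfold crossSum
  rw [pastCount_congr hu]
  refine Finset.sum_congr rfl fun k hk => ?_
  rw [position_congr fun i hi => hv i (by have := Finset.mem_range.1 hk; omega)]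

lemma crossWeight_congr {L : ℕ} {T s lam : ℝ} {u v u' v' : ℕ → Step d}
    (hu : ∀ i < L, u i = u' i) (hv : ∀ i < L, v i = v' i) :
    crossWeight L T s lam u v = crossWeight L T s lam u' v' := by
  unfold crossWeight
  rw [crossSum_congr hu hv]
  by_cases h : Spread L T s u
  · rw [if_pos h, if_pos ((spread_congr hu).1 h)]
  · rw [if_neg h, if_neg (mt (spread_congr hu).2 h)]

lemma pastCharge_nonneg {T : ℝ} (hT : 0 ≤ T) (L : ℕ) (u : ℕ → Step d) (x : Fin d → ℤ) :
    0 ≤ pastCharge L T u x := le_min (Nat.cast_nonneg _) hT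

lemma potential_pastCharge_le [NeZero d] (L : ℕ) (T : ℝ) (u : ℕ → Step d) (r : ℕ)
    (z : Fin d → ℤ) :
    potential (fun x => ENNReal.ofReal (pastCharge L T u x)) z ≤
      r * ENNReal.ofReal T + ∑ i ∈ Finset.Icc 1 L, tailGreen d r z (position i u) := by
  refine potential_le_of_count _ (fun i => position i u)
    (fun x => ENNReal.ofReal_le_ofReal (min_le_right _ _)) (fun x => ?_) r z
  refine (ENNReal.ofReal_le_ofReal (min_le_left _ _)).trans ?_
  rw [ENNReal.ofReal_natCast, pastCount, Finset.card_filter]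
  push_cast
  exact Finset.sum_le_sum fun i _ => by simp [eq_comm]

/-- Khasminskii's bound is applied to the future with the past frozen. The level `s` enters only
through the admissible `λ`; the multiplicative term is the potential at the origin, whose mean over
the past is at most `∑ G_d²`. -/
lemma lintegral_crossWeight_le [NeZero d] (L : ℕ) {T s lam : ℝ} (hT : 0 ≤ T) (hlam : 0 ≤ lam)
    (hs : lam * s < 1) :
    ∫⁻ u, ∫⁻ v, crossWeight L T s lam u v ∂walkLaw d ∂walkLaw d ≤
      1 + ENNReal.ofReal (lam / (1 - lam * s)) * ∑' x, green d x ^ 2 := by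
  have h1 : ∀ u : ℕ → Step d, ∫⁻ v, crossWeight L T s lam u v ∂walkLaw d ≤
      1 + ENNReal.ofReal (lam / (1 - lam * s)) *
        ∑ i ∈ Finset.Icc 1 L, green d (position i u) := by
    intro u
    by_cases hu : Spread L T s u
    · have h2 := lintegral_exp_le (f := pastCharge L T u) (pastCharge_nonneg hT L u) hlam hs
        (fun z hz => hu z fun h0 => hz (by simp [pastCharge, h0, hT])) L 0
      simp only [zero_add] at h2
      simp only [crossWeight, hu, if_true]
      refine h2.trans ?_
      gcongr
      -- With `r = 0` the truncation plays no part and the bound is the sum of `G_d` over the past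
      -- positions.
      have h3 := potential_pastCharge_le L T u 0 0
      simpa [tailGreen_zero_zero] using h3
    · simp [crossWeight, hu]
  refine (lintegral_mono h1).trans ?_
  have hm : ∀ i ∈ Finset.Icc 1 L, Measurable fun u : ℕ → Step d => green d (position i u) :=
    fun i _ => measurable_comp_position _ i
  rw [lintegral_add_left measurable_const, lintegral_const_mul _ (Finset.measurable_sum _ hm),
    lintegral_finsetSum _ hm]
  simp only [lintegral_const, measure_univ, mul_one]
  gcongr
  exact sum_lintegral_green_le _

/-- The weight of the `k`-th dyadic block at level `l`. -/
def blockWeight (T s lam : ℝ) (l k : ℕ) (ω : ℕ → Step d) : ℝ≥0∞ :=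
  crossWeight (2 ^ l) T s lam (rev ((2 * k + 1) * 2 ^ l) ω) (future ((2 * k + 1) * 2 ^ l) ω)

lemma blockWeight_congr {T s lam : ℝ} {l k N : ℕ} (hN : (2 * k + 2) * 2 ^ l ≤ N)
    {u v : ℕ → Step d} (h : ∀ i < N, u i = v i) :
    blockWeight T s lam l k u = blockWeight T s lam l k v := by
  have e1 : (2 * k + 1) * 2 ^ l = 2 * k * 2 ^ l + 2 ^ l := by ring
  have e2 : (2 * k + 2) * 2 ^ l = (2 * k + 1) * 2 ^ l + 2 ^ l := by ring
  refine crossWeight_congr (fun i hi => rev_congr (fun i hi => h i (by omega)) i (by omega))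
    fun i hi => h _ (by omega)

lemma blockWeight_splice (T s lam : ℝ) (l K : ℕ) (u v : ℕ → Step d) :
    blockWeight T s lam l K (splice (2 * K * 2 ^ l) u v) =
      crossWeight (2 ^ l) T s lam (rev (2 ^ l) v) (future (2 ^ l) v) := by
  have e1 : (2 * K + 1) * 2 ^ l = 2 * K * 2 ^ l + 2 ^ l := by ring
  unfold blockWeight
  rw [e1]
  refine crossWeight_congr (fun i hi => ?_) fun i hi => ?_
  · unfold rev splice
    rw [if_pos (by omega), if_pos hi, if_neg (by omega)]
    congr 2; omega
  · unfold future splice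
    rw [if_neg (by omega)]
    congr 1; omega

lemma prod_blockWeight_congr {T s lam : ℝ} {l K N : ℕ} (hN : 2 * K * 2 ^ l ≤ N)
    {u v : ℕ → Step d} (h : ∀ i < N, u i = v i) :
    ∏ k ∈ Finset.range K, blockWeight T s lam l k u =
      ∏ k ∈ Finset.range K, blockWeight T s lam l k v := by
  refine Finset.prod_congr rfl fun k hk => blockWeight_congr (le_trans ?_ hN) h
  have := Finset.mem_range.1 hk
  exact Nat.mul_le_mul_right _ (by omega)

/-- The blocks of one level are independent. -/
lemma lintegral_prod_blockWeight_le [NeZero d] (l K : ℕ) {T s lam : ℝ} (hT : 0 ≤ T)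
    (hlam : 0 ≤ lam) (hs : lam * s < 1) :
    ∫⁻ ω, ∏ k ∈ Finset.range K, blockWeight T s lam l k ω ∂walkLaw d ≤
      (1 + ENNReal.ofReal (lam / (1 - lam * s)) * ∑' x, green d x ^ 2) ^ K := by
  induction K with
  | zero => simp
  | succ K ih =>
    -- The cut is at the start of block `K`: earlier blocks see only the first walk, and the last
    -- block sees only the fresh one.
    rw [lintegral_splice (2 * K * 2 ^ l) (2 * (K + 1) * 2 ^ l)
      (fun u v h => prod_blockWeight_congr le_rfl h)]
    have h1 : ∀ u v : ℕ → Step d, ∏ k ∈ Finset.range (K + 1),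
        blockWeight T s lam l k (splice (2 * K * 2 ^ l) u v) =
        (∏ k ∈ Finset.range K, blockWeight T s lam l k u) *
          crossWeight (2 ^ l) T s lam (rev (2 ^ l) v) (future (2 ^ l) v) := by
      intro u v
      rw [Finset.prod_range_succ, blockWeight_splice,
        prod_blockWeight_congr le_rfl fun i hi => splice_of_lt hi u v]
    simp_rw [h1]
    have hm : Measurable fun v : ℕ → Step d =>
        crossWeight (2 ^ l) T s lam (rev (2 ^ l) v) (future (2 ^ l) v) := by
      refine measurable_of_dependsOn (2 ^ l + 2 ^ l) fun u v h => ?_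
      exact crossWeight_congr (rev_congr fun i hi => h i (by omega)) fun i hi => h _ (by omega)
    have hm' : Measurable fun u : ℕ → Step d =>
        ∏ k ∈ Finset.range K, blockWeight T s lam l k u :=
      measurable_of_dependsOn (2 * K * 2 ^ l) fun u v h => prod_blockWeight_congr le_rfl h
    simp_rw [lintegral_const_mul _ hm]
    rw [lintegral_mul_const _ hm', lintegral_rev_future (2 ^ l) (2 ^ l)
      (F := fun u v => crossWeight (2 ^ l) T s lam u v)
      (fun u v u' v' hu hv => crossWeight_congr hu hv), pow_succ]
    exact mul_le_mul' ih (lintegral_crossWeight_le _ hT hlam hs)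

lemma measure_level_le [NeZero d] (l K : ℕ) {T s lam : ℝ} (hT : 0 ≤ T)
    (hlam : 0 ≤ lam) (hs : lam * s < 1) (U : ℝ) :
    walkLaw d {ω | (∀ k < K, Spread (2 ^ l) T s (rev ((2 * k + 1) * 2 ^ l) ω)) ∧
      U ≤ ∑ k ∈ Finset.range K, dyadicCross T l k ω} ≤
      ENNReal.ofReal (Real.exp (-(lam * U))) *
        (1 + ENNReal.ofReal (lam / (1 - lam * s)) * ∑' x, green d x ^ 2) ^ K := by
  have hm : Measurable fun u : ℕ → Step d =>
      ∏ k ∈ Finset.range K, blockWeight T s lam l k u :=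
    measurable_of_dependsOn (2 * K * 2 ^ l) fun u v h => prod_blockWeight_congr le_rfl h
  have h1 : {ω : ℕ → Step d | (∀ k < K, Spread (2 ^ l) T s (rev ((2 * k + 1) * 2 ^ l) ω)) ∧
      U ≤ ∑ k ∈ Finset.range K, dyadicCross T l k ω} ⊆
      {ω | ENNReal.ofReal (Real.exp (lam * U)) ≤
        ∏ k ∈ Finset.range K, blockWeight T s lam l k ω} := by
    rintro ω ⟨hω, hU⟩
    have h2 : ∏ k ∈ Finset.range K, blockWeight T s lam l k ω =
        ENNReal.ofReal (Real.exp (lam * ∑ k ∈ Finset.range K, dyadicCross T l k ω)) := by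
      rw [Finset.mul_sum, Real.exp_sum,
        ENNReal.ofReal_prod_of_nonneg fun _ _ => (Real.exp_pos _).le]
      refine Finset.prod_congr rfl fun k hk => ?_
      simp only [blockWeight, crossWeight, hω k (Finset.mem_range.1 hk), if_true]
      rfl
    simp only [Set.mem_ofPred_eq]
    rw [h2]
    exact ENNReal.ofReal_le_ofReal (Real.exp_le_exp.2 (mul_le_mul_of_nonneg_left hU hlam))
  have h3 := mul_meas_ge_le_lintegral (μ := walkLaw d) hm (ENNReal.ofReal (Real.exp (lam * U)))
  calc _ ≤ walkLaw d _ := measure_mono h1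
    _ = ENNReal.ofReal (Real.exp (-(lam * U))) * (ENNReal.ofReal (Real.exp (lam * U)) *
        walkLaw d {ω | ENNReal.ofReal (Real.exp (lam * U)) ≤
          ∏ k ∈ Finset.range K, blockWeight T s lam l k ω}) := by
        rw [← mul_assoc, ← ENNReal.ofReal_mul (Real.exp_pos _).le, ← Real.exp_add]
        simp
    _ ≤ _ := mul_le_mul_right (h3.trans (lintegral_prod_blockWeight_le l K hT hlam hs)) _

/-! ### Deviations of the truncated intersections -/

/-- The cube of side `2 n + 1` centred at the origin. -/
def box (d n : ℕ) : Finset (Fin d → ℤ) := Fintype.piFinset fun _ => Finset.Icc (-(n : ℤ)) n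

lemma card_box (d n : ℕ) : (box d n).card = (2 * n + 1) ^ d := by
  rw [box, Fintype.card_piFinset]
  simp only [Int.card_Icc, Finset.prod_const, Finset.card_univ, Fintype.card_fin]
  congr 1
  omega

lemma abs_stepVec_le (s : Step d) (j : Fin d) : |stepVec s j| ≤ 1 := by
  rcases s with ⟨i, b⟩
  by_cases h : j = i
  · subst h; cases b <;> simp [stepVec]
  · cases b <;> simp [stepVec, h]

lemma position_mem_box {k n : ℕ} (hk : k ≤ n) (ω : ℕ → Step d) : position k ω ∈ box d n := by
  have h1 : ∀ j, |position k ω j| ≤ k := by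
    intro j
    rw [position, Finset.sum_apply]
    refine (Finset.abs_sum_le_sum_abs _ _).trans ?_
    refine (Finset.sum_le_card_nsmul _ _ 1 fun i _ => abs_stepVec_le _ _).trans (by simp)
  rw [box, Fintype.mem_piFinset]
  intro j
  have h2 := abs_le.1 (h1 j)
  rw [Finset.mem_Icc]
  omega

/-- The constant of `exists_potential_tailGreen_le`. -/
def TailBound (d : ℕ) (C : ℝ) : Prop := 0 < C ∧ ∀ (r : ℕ) (z y : Fin d → ℤ), 0 < r →
  potential (tailGreen d r z) y ≤ ENNReal.ofReal (C * (r : ℝ) ^ (-(1 / 8) : ℝ))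

/-- If `Spread` fails at `z`, the additive functional of the past with density `tailGreen d r z`
exceeds `s - r T`, an event with an exponential tail because its potential is small. Only visited
`z` are tested, so the union bound runs over a box of polynomial size. -/
lemma measure_not_spread_le (hd : 5 ≤ d) {C : ℝ} (hC : TailBound d C) {L n r : ℕ} (hL : L ≤ n)
    (hr : 0 < r) {T s : ℝ} (hT : 0 ≤ T) :
    walkLaw d {u | ¬ Spread L T s u} ≤ ENNReal.ofReal ((2 * n + 1) ^ d *
      (2 * Real.exp (-((s - r * T) / (2 * (C * (r : ℝ) ^ (-(1 / 8) : ℝ))))))) := by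
  have : NeZero d := ⟨by omega⟩
  have hr' : (0 : ℝ) < r := by exact_mod_cast hr
  have hC0 := hC.1
  have h1 : {u : ℕ → Step d | ¬ Spread L T s u} ⊆ ⋃ z ∈ box d n,
      {u | s - r * T ≤ ∑ k ∈ Finset.range (n + 1), (tailGreen d r z (position k u)).toReal} := by
    intro u hu
    simp only [Set.mem_ofPred_eq, Spread, not_forall, not_le] at hu
    obtain ⟨z, hz, hzs⟩ := hu
    simp only [Set.mem_iUnion, Set.mem_ofPred_eq]
    refine ⟨z, ?_, ?_⟩
    · obtain ⟨k, hk⟩ := Finset.card_ne_zero.1 hz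
      rw [Finset.mem_filter, Finset.mem_Icc] at hk
      rw [← hk.2]
      exact position_mem_box (by omega) u
    · have h2 := hzs.trans_le (potential_pastCharge_le L T u r z)
      have h3 : r * ENNReal.ofReal T + ∑ i ∈ Finset.Icc 1 L, tailGreen d r z (position i u) =
          ENNReal.ofReal (r * T + ∑ i ∈ Finset.Icc 1 L,
            (tailGreen d r z (position i u)).toReal) := by
        rw [ENNReal.ofReal_add (by positivity) (Finset.sum_nonneg fun _ _ => ENNReal.toReal_nonneg),
          ENNReal.ofReal_mul hr'.le, ENNReal.ofReal_natCast,
          ENNReal.ofReal_sum_of_nonneg fun _ _ => ENNReal.toReal_nonneg]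
        congr 1
        exact Finset.sum_congr rfl fun i _ => (ENNReal.ofReal_toReal (tailGreen_ne_top hd _ _ _)).symm
      rw [h3] at h2
      have h4 := (ENNReal.ofReal_lt_ofReal_iff'.1 h2).1
      have h5 : ∑ i ∈ Finset.Icc 1 L, (tailGreen d r z (position i u)).toReal ≤
          ∑ k ∈ Finset.range (n + 1), (tailGreen d r z (position k u)).toReal := by
        refine Finset.sum_le_sum_of_subset_of_nonneg (fun i hi => ?_)
          fun _ _ _ => ENNReal.toReal_nonneg
        rw [Finset.mem_Icc] at hi
        exact Finset.mem_range.2 (by omega)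
      linarith
  refine (measure_mono h1).trans ((measure_biUnion_finset_le _ _).trans ?_)
  have h2 : ∀ z ∈ box d n, walkLaw d
      {u | s - r * T ≤ ∑ k ∈ Finset.range (n + 1), (tailGreen d r z (position k u)).toReal} ≤
      ENNReal.ofReal (2 * Real.exp (-((s - r * T) / (2 * (C * (r : ℝ) ^ (-(1 / 8) : ℝ)))))) := by
    intro z _
    refine measure_sum_ge_le (f := fun x => (tailGreen d r z x).toReal)
      (fun x => ENNReal.toReal_nonneg) (by positivity) (fun y => ?_) _ _
    simp_rw [ENNReal.ofReal_toReal (tailGreen_ne_top hd _ _ _)]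
    exact hC.2 r z y hr
  refine (Finset.sum_le_sum h2).trans ?_
  rw [Finset.sum_const, card_box, nsmul_eq_mul,
    ENNReal.ofReal_mul (p := (2 * n + 1) ^ d) (by positivity)]
  gcongr
  rw [← ENNReal.ofReal_natCast]
  push_cast
  exact le_rfl

lemma measure_not_spread_rev [NeZero d] {L m : ℕ} (T s : ℝ) :
    walkLaw d {ω | ¬ Spread L T s (rev m ω)} = walkLaw d {u | ¬ Spread L T s u} := by
  refine (measurePreserving_rev m).measure_preimage (s := {u | ¬ Spread L T s u}) ?_
  exact (measurableSet_of_dependsOn L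
    fun u v h => by rw [spread_congr h]).nullMeasurableSet

/-- The mean `K g` contained in `U` cancels the first-order term in `λ`. Since `1 / (1 - x) ≤ 1 +
2x` for `0 ≤ x ≤ 1/2`, the remainder is of second order. -/
lemma exp_mul_pow_le {lam s g U w : ℝ} {K n : ℕ} (hlam : 0 ≤ lam) (hs0 : 0 ≤ s)
    (hs : lam * s ≤ 1 / 2) (hg : 0 ≤ g) (hK : K ≤ n) (hU : K * g + w ≤ U) :
    Real.exp (-(lam * U)) * (1 + lam / (1 - lam * s) * g) ^ K ≤
      Real.exp (-(lam * w) + 2 * lam ^ 2 * s * g * n) := by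
  have h0 : 0 < 1 - lam * s := by linarith
  have h1 : lam / (1 - lam * s) ≤ lam + 2 * lam ^ 2 * s := by
    rw [div_le_iff₀ h0]
    have : 0 ≤ lam * (lam * s) * (1 - 2 * (lam * s)) :=
      mul_nonneg (by positivity) (by linarith)
    nlinarith
  have h2 : 1 + lam / (1 - lam * s) * g ≤ Real.exp ((lam + 2 * lam ^ 2 * s) * g) := by
    have := Real.add_one_le_exp ((lam + 2 * lam ^ 2 * s) * g)
    have h3 := mul_le_mul_of_nonneg_right h1 hg
    linarith
  have h4 : (0 : ℝ) ≤ 1 + lam / (1 - lam * s) * g := by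
    have := div_nonneg hlam h0.le
    positivity
  calc _ ≤ Real.exp (-(lam * U)) * Real.exp ((lam + 2 * lam ^ 2 * s) * g) ^ K := by gcongr
    _ = Real.exp (-(lam * U) + K * ((lam + 2 * lam ^ 2 * s) * g)) := by
      rw [← Real.exp_nat_mul, ← Real.exp_add]
    _ ≤ _ := by
      refine Real.exp_le_exp.2 ?_
      have h5 : lam * (K * g + w) ≤ lam * U := by gcongr
      have h6 : (K : ℝ) ≤ n := by exact_mod_cast hK
      have h7 : (2 * lam ^ 2 * s * g) * K ≤ (2 * lam ^ 2 * s * g) * n := by gcongr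
      nlinarith

/-- A geometric series, plus a rounding error of at most `1/2` per level; this is the origin of the
logarithm. -/
lemma sum_numBlocks_le (n l₀ : ℕ) :
    ∑ l ∈ Finset.Ico l₀ (Nat.log 2 n + 1), (numBlocks n l : ℝ) ≤
      n / 2 ^ l₀ + (Nat.log 2 n + 1) / 2 := by
  have h1 : ∀ N : ℕ, ∑ l ∈ Finset.range N, (n : ℝ) / 2 ^ (l₀ + l + 1) ≤ n / 2 ^ l₀ := by
    intro N
    have h2 : ∑ l ∈ Finset.range N, (n : ℝ) / 2 ^ (l₀ + l + 1) =
        n / 2 ^ l₀ - n / 2 ^ (l₀ + N) := by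
      induction N with
      | zero => simp
      | succ N ih =>
        rw [Finset.sum_range_succ, ih, ← add_assoc, pow_succ]
        ring
    rw [h2]
    have : (0 : ℝ) ≤ n / 2 ^ (l₀ + N) := by positivity
    linarith
  refine (Finset.sum_le_sum fun l _ => numBlocks_le n l).trans ?_
  rw [Finset.sum_add_distrib, Finset.sum_Ico_eq_sum_range, Finset.sum_const, nsmul_eq_mul]
  refine add_le_add (h1 _) ?_
  rw [Nat.card_Ico, mul_one_div]
  have : ((Nat.log 2 n + 1 - l₀ : ℕ) : ℝ) ≤ ((Nat.log 2 n + 1 : ℕ) : ℝ) := by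
    exact_mod_cast Nat.sub_le _ _
  push_cast at this
  linarith

/-- Deviations of the truncated intersections between different dyadic blocks. -/
lemma measure_sum_dyadicCross_ge_le (hd : 5 ≤ d) {C : ℝ} (hC : TailBound d C) {n r : ℕ} (l₀ : ℕ)
    (hr : 0 < r) {T s lam η U : ℝ} (hT : 0 ≤ T) (hlam : 0 ≤ lam) (hs0 : 0 ≤ s)
    (hs : lam * s ≤ 1 / 2) (hη : 0 ≤ η)
    (hU : (∑' x, green d x ^ 2).toReal * (n / 2 ^ l₀ + (Nat.log 2 n + 1) / 2) + η * n < U) :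
    walkLaw d {ω | U ≤ ∑ l ∈ Finset.Ico l₀ (Nat.log 2 n + 1),
        ∑ k ∈ Finset.range (numBlocks n l), dyadicCross T l k ω} ≤
      ENNReal.ofReal ((n + 1) ^ 2 * ((2 * n + 1) ^ d *
        (2 * Real.exp (-((s - r * T) / (2 * (C * (r : ℝ) ^ (-(1 / 8) : ℝ))))))) +
      (n + 1) * Real.exp (-(lam * (η * n / (Nat.log 2 n + 1))) +
        2 * lam ^ 2 * s * (∑' x, green d x ^ 2).toReal * n)) := by
  have : NeZero d := ⟨by omega⟩
  set g := (∑' x, green d x ^ 2).toReal with hg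
  have hg' : ∑' x, green d x ^ 2 = ENNReal.ofReal g :=
    (ENNReal.ofReal_toReal (tsum_green_sq_ne_top hd)).symm
  have hg0 : 0 ≤ g := ENNReal.toReal_nonneg
  set I := Finset.Ico l₀ (Nat.log 2 n + 1) with hI
  -- The excess `η n` is shared equally among the at most `log₂ n + 1` levels, which need not be
  -- independent of each other.
  set w : ℝ := η * n / (Nat.log 2 n + 1) with hw
  set Q : ℝ := (2 * n + 1) ^ d *
        (2 * Real.exp (-((s - r * T) / (2 * (C * (r : ℝ) ^ (-(1 / 8) : ℝ)))))) with hQ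
  set R : ℝ := Real.exp (-(lam * w) + 2 * lam ^ 2 * s * g * n) with hR
  have hlog : Nat.log 2 n ≤ n := Nat.log_le_self 2 n
  have hIcard : I.card ≤ n + 1 := by rw [hI, Nat.card_Ico]; omega
  have hblocks : ∀ l, numBlocks n l ≤ n := by
    intro l
    unfold numBlocks
    have := Nat.div_le_self n (2 ^ l)
    rcases Nat.eq_zero_or_pos n with rfl | h
    · simp
    · omega
  -- Either some block has a past that is not spread, or all are spread and some level exceeds its
  -- mean bound by `w`.
  have h1 : {ω : ℕ → Step d | U ≤ ∑ l ∈ I, ∑ k ∈ Finset.range (numBlocks n l),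
        dyadicCross T l k ω} ⊆
      (⋃ l ∈ I, ⋃ k ∈ Finset.range (numBlocks n l),
        {ω | ¬ Spread (2 ^ l) T s (rev ((2 * k + 1) * 2 ^ l) ω)}) ∪
      ⋃ l ∈ I, {ω | (∀ k < numBlocks n l, Spread (2 ^ l) T s (rev ((2 * k + 1) * 2 ^ l) ω)) ∧
        numBlocks n l * g + w ≤ ∑ k ∈ Finset.range (numBlocks n l), dyadicCross T l k ω} := by
    intro ω hω
    by_contra hcon
    simp only [Set.mem_union, Set.mem_iUnion, Set.mem_ofPred_eq, not_or, not_exists, not_and,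
      not_not, not_le, Finset.mem_range] at hcon
    have h2 : ∀ l ∈ I, ∑ k ∈ Finset.range (numBlocks n l), dyadicCross T l k ω ≤
        numBlocks n l * g + w := fun l hl => (hcon.2 l hl (hcon.1 l hl)).le
    have h3 := Finset.sum_le_sum h2
    rw [Finset.sum_add_distrib, ← Finset.sum_mul, Finset.sum_const, nsmul_eq_mul] at h3
    have h4 := mul_le_mul_of_nonneg_right (sum_numBlocks_le n l₀) hg0
    have h5 : (I.card : ℝ) * w ≤ η * n := by
      have h6 : (I.card : ℝ) ≤ Nat.log 2 n + 1 := by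
        have : I.card ≤ Nat.log 2 n + 1 := by rw [hI, Nat.card_Ico]; omega
        exact_mod_cast this
      calc (I.card : ℝ) * w ≤ (Nat.log 2 n + 1) * w := by
            have : 0 ≤ w := by positivity
            gcongr
        _ = η * n := by rw [hw]; field_simp
    have h7 : U ≤ _ := hω
    rw [mul_comm g] at hU
    linarith
  refine (measure_mono h1).trans ((measure_union_le _ _).trans ?_)
  rw [ENNReal.ofReal_add (by positivity) (by positivity)]
  refine add_le_add ?_ ?_
  · refine (measure_biUnion_finset_le _ _).trans ?_
    have h2 : ∀ l ∈ I, walkLaw d (⋃ k ∈ Finset.range (numBlocks n l),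
        {ω | ¬ Spread (2 ^ l) T s (rev ((2 * k + 1) * 2 ^ l) ω)}) ≤
        ENNReal.ofReal ((n + 1) * Q) := by
      intro l hl
      refine (measure_biUnion_finset_le _ _).trans ?_
      have h3 : ∀ k ∈ Finset.range (numBlocks n l), walkLaw d
          {ω | ¬ Spread (2 ^ l) T s (rev ((2 * k + 1) * 2 ^ l) ω)} ≤ ENNReal.ofReal Q := by
        intro k hk
        rw [measure_not_spread_rev]
        refine measure_not_spread_le hd hC ?_ hr hT
        have := midpoint_le (Finset.mem_range.1 hk)
        nlinarith [Nat.zero_le (2 * k * 2 ^ l)]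
      refine (Finset.sum_le_sum h3).trans ?_
      rw [Finset.sum_const, Finset.card_range, nsmul_eq_mul,
        ENNReal.ofReal_mul (p := n + 1) (by positivity)]
      gcongr
      rw [← ENNReal.ofReal_natCast]
      refine ENNReal.ofReal_le_ofReal ?_
      have : (numBlocks n l : ℝ) ≤ n := by exact_mod_cast hblocks l
      linarith
    refine (Finset.sum_le_sum h2).trans ?_
    rw [Finset.sum_const, nsmul_eq_mul, ← ENNReal.ofReal_natCast,
      ← ENNReal.ofReal_mul (Nat.cast_nonneg _)]
    refine ENNReal.ofReal_le_ofReal ?_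
    rw [sq, mul_assoc]
    gcongr
    exact_mod_cast hIcard
  · refine (measure_biUnion_finset_le _ _).trans ?_
    have h2 : ∀ l ∈ I, walkLaw d {ω | (∀ k < numBlocks n l,
        Spread (2 ^ l) T s (rev ((2 * k + 1) * 2 ^ l) ω)) ∧
        numBlocks n l * g + w ≤ ∑ k ∈ Finset.range (numBlocks n l), dyadicCross T l k ω} ≤
        ENNReal.ofReal R := by
      intro l _
      refine (measure_level_le l _ hT hlam (by linarith) _).trans ?_
      have h0 : 0 ≤ lam / (1 - lam * s) := div_nonneg hlam (by linarith)
      rw [hg', ← ENNReal.ofReal_mul h0, ← ENNReal.ofReal_one,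
        ← ENNReal.ofReal_add zero_le_one (by positivity),
        ← ENNReal.ofReal_pow (by positivity), ← ENNReal.ofReal_mul (Real.exp_pos _).le]
      exact ENNReal.ofReal_le_ofReal
        (exp_mul_pow_le hlam hs0 hs hg0 (hblocks l) le_rfl)
    refine (Finset.sum_le_sum h2).trans ?_
    rw [Finset.sum_const, nsmul_eq_mul, ← ENNReal.ofReal_natCast,
      ← ENNReal.ofReal_mul (Nat.cast_nonneg _)]
    refine ENNReal.ofReal_le_ofReal ?_
    gcongr
    exact_mod_cast hIcard

/-! ### Sites with large local time -/

/-- The constant of `exists_potential_indicator_le`. -/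
def IndicatorBound (d : ℕ) (C : ℝ) : Prop := 0 < C ∧
  ∀ (Λ : Finset (Fin d → ℤ)) (z : Fin d → ℤ), Λ.Nonempty →
    potential (fun x => ENNReal.ofReal (if x ∈ Λ then 1 else 0)) z ≤
      ENNReal.ofReal (C * (Λ.card : ℝ) ^ (4 / 9 : ℝ))

lemma sum_indicator_position (n : ℕ) (ω : ℕ → Step d) (Λ : Finset (Fin d → ℤ)) :
    ∑ k ∈ Finset.range (n + 1), (if position k ω ∈ Λ then (1 : ℝ) else 0) =
      ∑ x ∈ Λ, (localTime n x ω : ℝ) := by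
  simp_rw [localTime, Finset.card_filter]
  push_cast
  rw [Finset.sum_comm]
  refine Finset.sum_congr rfl fun k _ => ?_
  rw [Finset.sum_ite_eq]

/-- It is unlikely that some set of `j` sites has local times at least `τ`. -/
lemma measure_exists_large_le [NeZero d] {C : ℝ} (hC : IndicatorBound d C) {j : ℕ} (hj : 0 < j)
    (n : ℕ) (τ : ℝ) :
    walkLaw d {ω | ∃ Λ ⊆ box d n, Λ.card = j ∧ ∀ x ∈ Λ, τ ≤ localTime n x ω} ≤
      ENNReal.ofReal ((2 * n + 1) ^ (d * j) *
        (2 * Real.exp (-(τ * (j : ℝ) ^ (5 / 9 : ℝ) / (2 * C))))) := by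
  have hC0 := hC.1
  have hj' : (0 : ℝ) < j := by exact_mod_cast hj
  have h1 : {ω : ℕ → Step d | ∃ Λ ⊆ box d n, Λ.card = j ∧ ∀ x ∈ Λ, τ ≤ localTime n x ω} ⊆
      ⋃ Λ ∈ (box d n).powersetCard j,
        {ω | τ * j ≤ ∑ k ∈ Finset.range (n + 1), if position k ω ∈ Λ then (1 : ℝ) else 0} := by
    rintro ω ⟨Λ, hΛ, hcard, h⟩
    simp only [Set.mem_iUnion, Set.mem_ofPred_eq]
    refine ⟨Λ, Finset.mem_powersetCard.2 ⟨hΛ, hcard⟩, ?_⟩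
    rw [sum_indicator_position, mul_comm, ← hcard, ← nsmul_eq_mul]
    exact Finset.card_nsmul_le_sum _ _ _ h
  refine (measure_mono h1).trans ((measure_biUnion_finset_le _ _).trans ?_)
  have h2 : ∀ Λ ∈ (box d n).powersetCard j, walkLaw d
      {ω | τ * j ≤ ∑ k ∈ Finset.range (n + 1), if position k ω ∈ Λ then (1 : ℝ) else 0} ≤
      ENNReal.ofReal (2 * Real.exp (-(τ * (j : ℝ) ^ (5 / 9 : ℝ) / (2 * C)))) := by
    intro Λ hΛ
    have hcard := (Finset.mem_powersetCard.1 hΛ).2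
    -- The total time `τ j` divided by the potential bound `C j^(4/9)` leaves the exponent `τ
    -- j^(5/9)`.
    refine (measure_sum_ge_le (f := fun x => if x ∈ Λ then (1 : ℝ) else 0)
      (fun x => by positivity) (σ := C * (j : ℝ) ^ (4 / 9 : ℝ)) (by positivity)
      (fun z => ?_) (n + 1) (τ * j)).trans (le_of_eq ?_)
    · have := hC.2 Λ z (Finset.card_pos.1 (by omega))
      rwa [hcard] at this
    · congr 4
      have : (j : ℝ) = (j : ℝ) ^ (5 / 9 : ℝ) * (j : ℝ) ^ (4 / 9 : ℝ) := by
        rw [← Real.rpow_add hj']; norm_num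
      rw [show τ * (j : ℝ) = τ * (j : ℝ) ^ (5 / 9 : ℝ) * (j : ℝ) ^ (4 / 9 : ℝ) by
        rw [mul_assoc, ← this]]
      field_simp
  refine (Finset.sum_le_sum h2).trans ?_
  rw [Finset.sum_const, Finset.card_powersetCard, card_box, nsmul_eq_mul, ← ENNReal.ofReal_natCast,
    ← ENNReal.ofReal_mul (Nat.cast_nonneg _)]
  refine ENNReal.ofReal_le_ofReal ?_
  gcongr
  calc ((((2 * n + 1) ^ d).choose j : ℕ) : ℝ) ≤ ((((2 * n + 1) ^ d) ^ j : ℕ) : ℝ) := by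
        exact_mod_cast Nat.choose_le_pow _ _
    _ = _ := by push_cast; rw [pow_mul]

/-- If every subset of size `j` contains a value below `w j`, the sum is at most `∑ w j`. -/
lemma sum_le_sum_of_forall_subset {α : Type*} [DecidableEq α] (a : α → ℝ) (w : ℕ → ℝ)
    (F : Finset α) (h : ∀ Λ ⊆ F, Λ.Nonempty → ∃ x ∈ Λ, a x < w Λ.card) :
    ∑ x ∈ F, a x ≤ ∑ j ∈ Finset.range F.card, w (j + 1) := by
  induction hn : F.card generalizing F with
  | zero => rw [Finset.card_eq_zero.1 hn]; simp
  | succ n ih =>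
    -- The element supplied for `F` itself is charged to the index `F.card` and removed, so no
    -- ordering of the values is needed.
    obtain ⟨x, hx, hax⟩ := h F subset_rfl (Finset.card_pos.1 (by omega))
    have h1 := ih (F.erase x) (fun Λ hΛ => h Λ (hΛ.trans (Finset.erase_subset _ _)))
      (by rw [Finset.card_erase_of_mem hx]; omega)
    rw [← Finset.add_sum_erase F a hx, Finset.sum_range_succ]
    rw [hn] at hax
    linarith

lemma visited_subset_box (n : ℕ) (ω : ℕ → Step d) : visited n ω ⊆ box d n := by
  intro x hx
  obtain ⟨k, hk, rfl⟩ := Finset.mem_image.1 hx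
  exact position_mem_box (by have := Finset.mem_range.1 hk; omega) ω

/-- Deviations of the contribution of the sites with local time above `t`. -/
lemma exists_measure_highSum_ge_le [NeZero d] {C : ℝ} (hC : IndicatorBound d C) {y : ℝ}
    (hy : 0 < y) : ∃ c : ℝ, 0 < c ∧ ∀ (n J : ℕ) (t : ℝ), 0 < n → 0 < J →
    walkLaw d {ω | n * y ≤ highSum n t ω} ≤
      ENNReal.ofReal ((2 * n + 1) ^ (d * J) *
        (2 * Real.exp (-(t * (J : ℝ) ^ (5 / 9 : ℝ) / (2 * C)))) +
        J * ((2 * n + 1) ^ (d * J) * (2 * Real.exp (-(c * √n))))) := by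
  have hC0 := hC.1
  have hsum : Summable fun j : ℕ => ((j : ℝ) + 1) ^ (-(10 / 9) : ℝ) := by
    have := (summable_nat_add_iff 1).2 (Real.summable_nat_rpow.2
      (by norm_num : (-(10 / 9) : ℝ) < -1))
    exact_mod_cast this
  set K : ℝ := ∑' j : ℕ, ((j : ℝ) + 1) ^ (-(10 / 9) : ℝ) with hK
  have hK0 : 0 < K := by
    have h0 := hsum.le_tsum 0 (fun j _ => by positivity)
    simp only [Nat.cast_zero, zero_add, Real.one_rpow] at h0
    linarith
  -- Thresholds `b √n j^(-5/9)` have squares with sum at most `b² K n = n y / 2`, strictly below `n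
  -- y`.
  set b : ℝ := √(y / (2 * K)) with hb
  have hb0 : 0 < b := by positivity
  refine ⟨b / (2 * C), by positivity, fun n J t hn hJ => ?_⟩
  have hn' : (0 : ℝ) < n := by exact_mod_cast hn
  have h1 : {ω : ℕ → Step d | n * y ≤ highSum n t ω} ⊆
      {ω | ∃ Λ ⊆ box d n, Λ.card = J ∧ ∀ x ∈ Λ, t ≤ localTime n x ω} ∪
      ⋃ j ∈ Finset.range (J - 1), {ω | ∃ Λ ⊆ box d n, Λ.card = j + 1 ∧ ∀ x ∈ Λ,
        b * √n * ((j : ℝ) + 1) ^ (-(5 / 9) : ℝ) ≤ localTime n x ω} := by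
    intro ω hω
    rw [Set.mem_ofPred_eq, highSum_eq] at hω
    set H := (visited n ω).filter fun x => t < (localTime n x ω : ℝ) with hH
    have hHbox : H ⊆ box d n := (Finset.filter_subset _ _).trans (visited_subset_box n ω)
    -- Either `J` sites exceed `t`, or there are fewer and some nonempty subset of size `j < J` lies
    -- entirely above the threshold for `j`.
    by_cases hcard : J ≤ H.card
    · left
      obtain ⟨Λ, hΛ, hΛc⟩ := Finset.exists_subset_card_eq hcard
      exact ⟨Λ, hΛ.trans hHbox, hΛc, fun x hx => (Finset.mem_filter.1 (hΛ hx)).2.le⟩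
    · right
      by_contra hcon
      simp only [Set.mem_iUnion, Set.mem_ofPred_eq, not_exists, not_and, not_forall, not_le,
        Finset.mem_range] at hcon
      have h2 := sum_le_sum_of_forall_subset (fun x => (localTime n x ω : ℝ) ^ 2)
        (fun j => n * (y / (2 * K)) * (j : ℝ) ^ (-(10 / 9) : ℝ)) H ?_
      · have h3 : ∑ j ∈ Finset.range H.card, ((j : ℝ) + 1) ^ (-(10 / 9) : ℝ) ≤ K :=
          hsum.sum_le_tsum _ fun j _ => by positivity
        push_cast at h2
        rw [← Finset.mul_sum] at h2
        have h4 : n * (y / (2 * K)) * ∑ j ∈ Finset.range H.card, ((j : ℝ) + 1) ^ (-(10 / 9) : ℝ) ≤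
            n * (y / (2 * K)) * K := by gcongr
        have h5 : n * (y / (2 * K)) * K = n * y / 2 := by field_simp
        have h6 : 0 < n * y := by positivity
        linarith
      · intro Λ hΛ hΛn
        have h7 := Finset.card_le_card hΛ
        have h8 := hΛn.card_pos
        obtain ⟨x, hx, hxl⟩ := hcon (Λ.card - 1) (by omega) Λ (hΛ.trans hHbox) (by omega)
        refine ⟨x, hx, ?_⟩
        have h9 : ((Λ.card - 1 : ℕ) : ℝ) + 1 = (Λ.card : ℝ) := by
          exact_mod_cast Nat.sub_add_cancel h8
        rw [h9] at hxl
        calc (localTime n x ω : ℝ) ^ 2 < (b * √n * (Λ.card : ℝ) ^ (-(5 / 9) : ℝ)) ^ 2 := by gcongr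
          _ = _ := by
            rw [mul_pow, mul_pow, Real.sq_sqrt hn'.le, hb, Real.sq_sqrt (by positivity),
              ← Real.rpow_natCast, ← Real.rpow_mul (by positivity),
              show (-(5 / 9) : ℝ) * ((2 : ℕ) : ℝ) = -(10 / 9) by norm_num]
            ring
  refine (measure_mono h1).trans ((measure_union_le _ _).trans ?_)
  rw [ENNReal.ofReal_add (by positivity) (by positivity)]
  refine add_le_add (measure_exists_large_le hC hJ n t) ?_
  refine (measure_biUnion_finset_le _ _).trans ?_
  have h2 : ∀ j ∈ Finset.range (J - 1), walkLaw d {ω | ∃ Λ ⊆ box d n, Λ.card = j + 1 ∧ ∀ x ∈ Λ,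
        b * √n * ((j : ℝ) + 1) ^ (-(5 / 9) : ℝ) ≤ localTime n x ω} ≤
      ENNReal.ofReal ((2 * n + 1) ^ (d * J) * (2 * Real.exp (-(b / (2 * C) * √n)))) := by
    intro j hj
    refine (measure_exists_large_le hC (Nat.succ_pos j) n _).trans (ENNReal.ofReal_le_ofReal ?_)
    have h3 : b * √n * ((j : ℝ) + 1) ^ (-(5 / 9) : ℝ) * ((j + 1 : ℕ) : ℝ) ^ (5 / 9 : ℝ) / (2 * C) =
        b / (2 * C) * √n := by
      push_cast
      rw [mul_assoc (b * √n), ← Real.rpow_add (by positivity)]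
      norm_num
      ring
    simp only [Nat.succ_eq_add_one]
    rw [h3]
    gcongr
    · have : (0 : ℝ) ≤ n := hn'.le
      linarith
    · have := Finset.mem_range.1 hj
      omega
  refine (Finset.sum_le_sum h2).trans ?_
  rw [Finset.sum_const, Finset.card_range, nsmul_eq_mul, ← ENNReal.ofReal_natCast,
    ← ENNReal.ofReal_mul (Nat.cast_nonneg _)]
  refine ENNReal.ofReal_le_ofReal ?_
  gcongr
  omega

/-! ### Decay on the exponential scale of the square root -/

/-- The sequence `p n` is eventually at most `exp (-c √n)`. -/
def Decays (c : ℝ) (p : ℕ → ℝ≥0∞) : Prop :=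
  ∀ᶠ n : ℕ in atTop, p n ≤ ENNReal.ofReal (Real.exp (-(c * √n)))

lemma sqrtRate_le_of_decays {c : ℝ} {p : ℕ → ℝ≥0∞} (h : Decays c p) :
    sqrtRate p ≤ ((-c : ℝ) : EReal) := by
  refine limsup_le_of_le (by isBoundedDefault) ?_
  filter_upwards [h, eventually_gt_atTop 0] with n hn hn0
  have hs : 0 < √(n : ℝ) := Real.sqrt_pos.2 (by exact_mod_cast hn0)
  have h1 : ENNReal.log (p n) ≤ ((-(c * √n) : ℝ) : EReal) := by
    refine (ENNReal.log_le_log hn).trans ?_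
    rw [ENNReal.log_ofReal_of_pos (Real.exp_pos _), Real.log_exp]
  calc ((1 / √(n : ℝ) : ℝ) : EReal) * ENNReal.log (p n)
      ≤ ((1 / √(n : ℝ) : ℝ) : EReal) * ((-(c * √n) : ℝ) : EReal) :=
        mul_le_mul_of_nonneg_left h1 (by exact_mod_cast (by positivity : (0 : ℝ) ≤ 1 / √(n : ℝ)))
    _ = ((-c : ℝ) : EReal) := by
        rw [← EReal.coe_mul]
        congr 1
        field_simp

lemma sqrtRate_eq_bot_of_decays {p : ℕ → ℝ≥0∞} (h : ∀ c : ℝ, 0 < c → Decays c p) :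
    sqrtRate p = ⊥ := by
  rw [EReal.eq_bot_iff_forall_lt]
  intro y
  refine (sqrtRate_le_of_decays (h (|y| + 1) (by positivity))).trans_lt ?_
  rw [EReal.coe_lt_coe_iff]
  linarith [neg_abs_le y]

lemma eventually_le_rpow {δ : ℝ} (hδ : 0 < δ) (K : ℝ) : ∀ᶠ n : ℕ in atTop, K ≤ (n : ℝ) ^ δ :=
  ((tendsto_rpow_atTop hδ).comp tendsto_natCast_atTop_atTop).eventually_ge_atTop K

lemma eventually_mul_rpow_le {δ δ' : ℝ} (h : δ < δ') (K : ℝ) :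
    ∀ᶠ n : ℕ in atTop, K * (n : ℝ) ^ δ ≤ (n : ℝ) ^ δ' := by
  filter_upwards [eventually_le_rpow (sub_pos.2 h) K, eventually_gt_atTop 0] with n hn hn0
  have hN : (0 : ℝ) < n := by exact_mod_cast hn0
  calc K * (n : ℝ) ^ δ ≤ (n : ℝ) ^ (δ' - δ) * (n : ℝ) ^ δ := by gcongr
    _ = _ := by rw [← Real.rpow_add hN]; congr 1; ring

lemma eventually_mul_log_le {δ : ℝ} (hδ : 0 < δ) {K : ℝ} (hK : 0 < K) :
    ∀ᶠ n : ℕ in atTop, K * Real.log n ≤ (n : ℝ) ^ δ := by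
  have h := (isLittleO_log_rpow_atTop hδ).bound (inv_pos.2 hK)
  filter_upwards [tendsto_natCast_atTop_atTop.eventually h] with n hn
  rw [Real.norm_eq_abs, Real.norm_eq_abs, abs_of_nonneg (by positivity : 0 ≤ (n : ℝ) ^ δ)] at hn
  rw [inv_mul_eq_div, le_div_iff₀ hK] at hn
  nlinarith [le_abs_self (Real.log n)]

lemma eventually_natLog_le {δ : ℝ} (hδ : 0 < δ) (K : ℝ) :
    ∀ᶠ n : ℕ in atTop, K * (Nat.log 2 n + 1) ≤ (n : ℝ) ^ δ := by
  have hl2 : 0 < Real.log 2 := Real.log_pos (by norm_num)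
  have hK : (0 : ℝ) < |K| + 1 := by positivity
  filter_upwards [eventually_mul_log_le hδ (K := 2 * (|K| + 1) / Real.log 2) (by positivity),
    eventually_le_rpow hδ (2 * (|K| + 1))] with n h1 h2
  have h3 : (Nat.log 2 n : ℝ) ≤ Real.log n / Real.log 2 := by
    have := Real.natLog_le_logb n 2
    rwa [Real.logb] at this
  have h4 : 2 * (|K| + 1) / Real.log 2 * Real.log n = 2 * ((|K| + 1) * (Real.log n / Real.log 2)) := by
    field_simp
  calc K * (Nat.log 2 n + 1) ≤ (|K| + 1) * (Nat.log 2 n + 1) := by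
        gcongr; linarith [le_abs_self K]
    _ ≤ (|K| + 1) * (Real.log n / Real.log 2 + 1) := by gcongr
    _ ≤ (n : ℝ) ^ δ := by linarith

lemma two_mul_add_one_pow_le {n m : ℕ} (hn : 3 ≤ n) :
    (2 * (n : ℝ) + 1) ^ m ≤ Real.exp (m * (2 * Real.log n)) := by
  have hn' : (3 : ℝ) ≤ n := by exact_mod_cast hn
  have h1 : Real.exp (2 * Real.log n) = (n : ℝ) ^ 2 := by
    rw [mul_comm, Real.exp_mul, Real.exp_log (by linarith)]; norm_num
  rw [Real.exp_nat_mul, h1]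
  gcongr
  nlinarith

/-- The spare unit in the rate absorbs the factor two of the sum. -/
lemma Decays.of_le_add {c : ℝ} {p : ℕ → ℝ≥0∞} {f g : ℕ → ℝ}
    (h : ∀ᶠ n : ℕ in atTop, p n ≤ ENNReal.ofReal (f n + g n))
    (hf : ∀ᶠ n : ℕ in atTop, f n ≤ Real.exp (-((c + 1) * √n)))
    (hg : ∀ᶠ n : ℕ in atTop, g n ≤ Real.exp (-((c + 1) * √n))) : Decays c p := by
  filter_upwards [h, hf, hg, eventually_ge_atTop 1] with n h1 h2 h3 h4
  refine h1.trans (ENNReal.ofReal_le_ofReal ?_)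
  have h5 : 1 ≤ √(n : ℝ) := Real.one_le_sqrt.2 (by exact_mod_cast h4)
  have h6 : (2 : ℝ) ≤ Real.exp √n := by linarith [Real.add_one_le_exp √(n : ℝ)]
  calc f n + g n ≤ 2 * Real.exp (-((c + 1) * √n)) := by linarith
    _ ≤ Real.exp √n * Real.exp (-((c + 1) * √n)) := by gcongr
    _ = _ := by rw [← Real.exp_add]; congr 1; ring

lemma Decays.add {c c' : ℝ} (hc : c' < c) {p q : ℕ → ℝ≥0∞} (hp : Decays c p) (hq : Decays c q) :
    Decays c' fun n => p n + q n := by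
  filter_upwards [hp, hq, eventually_le_rpow (δ := 1 / 2) (by norm_num) (1 / (c - c'))]
    with n h1 h2 h3
  rw [← Real.sqrt_eq_rpow, div_le_iff₀ (sub_pos.2 hc)] at h3
  refine (add_le_add h1 h2).trans ?_
  rw [← ENNReal.ofReal_add (Real.exp_pos _).le (Real.exp_pos _).le, ← two_mul]
  refine ENNReal.ofReal_le_ofReal ?_
  calc 2 * Real.exp (-(c * √n)) ≤ Real.exp (√n * (c - c')) * Real.exp (-(c * √n)) := by
        gcongr
        linarith [Real.add_one_le_exp (√n * (c - c'))]
    _ = _ := by rw [← Real.exp_add]; congr 1; ring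

lemma Decays.of_le {c : ℝ} {p q : ℕ → ℝ≥0∞} (hq : Decays c q) (h : ∀ᶠ n in atTop, p n ≤ q n) :
    Decays c p := by
  filter_upwards [hq, h] with n h1 h2 using h2.trans h1

/-! ### Choice of the parameters -/

/-- The truncated intersections at scales above `l₀` have super-exponentially small deviations. -/
lemma decays_sum_dyadicCross (hd : 5 ≤ d) {ε : ℝ} (hε : 0 < ε) (l₀ : ℕ) {a : ℝ}
    (ha : (∑' x, green d x ^ 2).toReal / 2 ^ l₀ < a) {c : ℝ} (hc : 0 < c) :
    Decays c fun n => walkLaw d {ω | n * a ≤ ∑ l ∈ Finset.Ico l₀ (Nat.log 2 n + 1),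
      ∑ k ∈ Finset.range (numBlocks n l), dyadicCross ((n : ℝ) ^ (1 / 2 - ε)) l k ω} := by
  obtain ⟨C, hC⟩ := exists_potential_tailGreen_le hd
  have hC0 := hC.1
  set g := (∑' x, green d x ^ 2).toReal with hg
  have hg0 : 0 ≤ g := ENNReal.toReal_nonneg
  set η : ℝ := (a - g / 2 ^ l₀) / 2 with hη
  have hη0 : 0 < η := by rw [hη]; linarith
  -- The choices are `T = n^(1/2-ε)`, `r = ⌈n^(ε/2)⌉`, `s = n^(1/2-ε/32)` and `λ = n^(-1/2+ε/64)`.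
  -- Then `r T` is negligible against `s`, the exponent `s r^(1/8)` is of order at least
  -- `n^(1/2+ε/32)`, `λ s` tends to zero, and `λ n / log n` beats `√n`.
  refine Decays.of_le_add (f := fun n : ℕ => ((n : ℝ) + 1) ^ 2 * ((2 * n + 1) ^ d *
        (2 * Real.exp (-(((n : ℝ) ^ (1 / 2 - ε / 32) -
          (⌈(n : ℝ) ^ (ε / 2)⌉₊ : ℝ) * (n : ℝ) ^ (1 / 2 - ε)) /
          (2 * (C * (⌈(n : ℝ) ^ (ε / 2)⌉₊ : ℝ) ^ (-(1 / 8) : ℝ))))))))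
    (g := fun n : ℕ => ((n : ℝ) + 1) * Real.exp (-((n : ℝ) ^ (-(1 / 2) + ε / 64) *
        (η * n / (Nat.log 2 n + 1))) +
        2 * ((n : ℝ) ^ (-(1 / 2) + ε / 64)) ^ 2 * (n : ℝ) ^ (1 / 2 - ε / 32) * g * n)) ?_ ?_ ?_
  · filter_upwards [eventually_gt_atTop 0, eventually_le_rpow (δ := ε / 64) (by positivity) 2,
      eventually_natLog_le (δ := 1) one_pos (g / η)] with n hn0 h1 h2
    have hN : (0 : ℝ) < n := by exact_mod_cast hn0
    refine measure_sum_dyadicCross_ge_le hd hC l₀ (Nat.ceil_pos.2 (by positivity))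
      (by positivity) (by positivity) (by positivity) ?_ hη0.le ?_
    · have e : (n : ℝ) ^ (-(1 / 2) + ε / 64) * (n : ℝ) ^ (1 / 2 - ε / 32) =
          ((n : ℝ) ^ (ε / 64))⁻¹ := by
        rw [← Real.rpow_add hN, ← Real.rpow_neg hN.le]; congr 1; ring
      rw [e, inv_le_comm₀ (by positivity) (by norm_num)]
      simpa using h1
    · rw [Real.rpow_one, div_mul_eq_mul_div, div_le_iff₀ hη0] at h2
      have h3 : (n : ℝ) * a = g * (n / 2 ^ l₀) + 2 * (η * n) := by rw [hη]; ring
      rw [← hg, h3]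
      have h4 : 0 < η * n := by positivity
      nlinarith
  · filter_upwards [eventually_ge_atTop 3,
      eventually_mul_log_le (δ := 1 / 2) (by norm_num) (K := 2 * (d + 3)) (by positivity),
      eventually_mul_rpow_le (δ := 1 / 2 - ε / 2) (δ' := 1 / 2 - ε / 32) (by linarith) 4,
      eventually_mul_rpow_le (δ := 1 / 2 - ε / 16) (δ' := 1 / 2 - ε / 32) (by linarith)
        (4 * C * (c + 2)), eventually_le_rpow (δ := ε / 2) (by positivity) 1]
      with n hn3 h1 h2 h3 h4
    have hN3 : (3 : ℝ) ≤ n := by exact_mod_cast hn3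
    have hN : (0 : ℝ) < n := by linarith
    set r : ℝ := (⌈(n : ℝ) ^ (ε / 2)⌉₊ : ℝ) with hr
    have hr1 : (n : ℝ) ^ (ε / 2) ≤ r := Nat.le_ceil _
    have hr2 : r ≤ 2 * (n : ℝ) ^ (ε / 2) := by
      have := Nat.ceil_lt_add_one (a := (n : ℝ) ^ (ε / 2)) (by positivity)
      linarith
    have hr0 : 0 < r := by linarith
    have hr3 : r ^ (-(1 / 8) : ℝ) ≤ (n : ℝ) ^ (-(ε / 16)) := by
      calc r ^ (-(1 / 8) : ℝ) ≤ ((n : ℝ) ^ (ε / 2)) ^ (-(1 / 8) : ℝ) :=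
            Real.rpow_le_rpow_of_nonpos (by positivity) hr1 (by norm_num)
        _ = _ := by rw [← Real.rpow_mul hN.le]; congr 1; ring
    have e1 : (n : ℝ) ^ (ε / 2) * (n : ℝ) ^ (1 / 2 - ε) = (n : ℝ) ^ (1 / 2 - ε / 2) := by
      rw [← Real.rpow_add hN]; congr 1; ring
    have e2 : (n : ℝ) ^ (1 / 2 : ℝ) * (n : ℝ) ^ (-(ε / 16)) = (n : ℝ) ^ (1 / 2 - ε / 16) := by
      rw [← Real.rpow_add hN]; congr 1
    have h5 : r * (n : ℝ) ^ (1 / 2 - ε) ≤ 2 * (n : ℝ) ^ (1 / 2 - ε / 2) := by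
      rw [← e1, ← mul_assoc]; gcongr
    have h6 : (c + 2) * √n ≤ ((n : ℝ) ^ (1 / 2 - ε / 32) - r * (n : ℝ) ^ (1 / 2 - ε)) /
          (2 * (C * r ^ (-(1 / 8) : ℝ))) := by
      rw [le_div_iff₀ (by positivity), Real.sqrt_eq_rpow]
      calc (c + 2) * (n : ℝ) ^ (1 / 2 : ℝ) * (2 * (C * r ^ (-(1 / 8) : ℝ)))
          ≤ (c + 2) * (n : ℝ) ^ (1 / 2 : ℝ) * (2 * (C * (n : ℝ) ^ (-(ε / 16)))) := by gcongr
        _ = (4 * C * (c + 2) * (n : ℝ) ^ (1 / 2 - ε / 16)) / 2 := by rw [← e2]; ring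
        _ ≤ _ := by linarith
    calc _ ≤ (2 * (n : ℝ) + 1) ^ 2 * ((2 * n + 1) ^ d * ((2 * n + 1) *
          Real.exp (-((c + 2) * √n)))) := by gcongr <;> linarith
      _ = (2 * (n : ℝ) + 1) ^ (d + 3) * Real.exp (-((c + 2) * √n)) := by ring
      _ ≤ Real.exp √n * Real.exp (-((c + 2) * √n)) := by
          gcongr
          refine (two_mul_add_one_pow_le hn3).trans (Real.exp_le_exp.2 ?_)
          rw [Real.sqrt_eq_rpow]
          push_cast
          linarith
      _ = _ := by rw [← Real.exp_add]; congr 1; ring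
  · filter_upwards [eventually_gt_atTop 0,
      eventually_natLog_le (δ := ε / 128) (by positivity) 1,
      eventually_mul_rpow_le (δ := 1 / 2 + ε / 128) (δ' := 1 / 2 + ε / 64) (by linarith)
        ((c + 2 + 2 * g) / η), eventually_mul_log_le (δ := 1 / 2) (by norm_num) (K := 2) (by norm_num),
      eventually_ge_atTop 3]
      with n hn0 h1 h2 h3 hn3
    have hN : (0 : ℝ) < n := by exact_mod_cast hn0
    rw [one_mul] at h1
    have e1 : (n : ℝ) ^ (-(1 / 2) + ε / 64) * n = (n : ℝ) ^ (1 / 2 + ε / 64) := by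
      conv_lhs => rw [← Real.rpow_one (n : ℝ)]
      rw [← Real.rpow_mul hN.le, ← Real.rpow_add hN]; congr 1; ring
    -- The second-order error `λ² s n` is exactly `√n`, hence smaller than the gain `λ η n / (log₂ n
    -- + 1)`.
    have e2 : ((n : ℝ) ^ (-(1 / 2) + ε / 64)) ^ 2 * (n : ℝ) ^ (1 / 2 - ε / 32) * n = √n := by
      calc _ = ((n : ℝ) ^ (-(1 / 2) + ε / 64)) ^ 2 * (n : ℝ) ^ (1 / 2 - ε / 32) * (n : ℝ) ^ (1 : ℝ) := by
            rw [Real.rpow_one]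
        _ = √n := by
            rw [sq, ← Real.rpow_add hN, ← Real.rpow_add hN, ← Real.rpow_add hN, Real.sqrt_eq_rpow]
            congr 1; ring
    have e3 : (n : ℝ) ^ (1 / 2 : ℝ) * (n : ℝ) ^ (ε / 128) = (n : ℝ) ^ (1 / 2 + ε / 128) :=
      (Real.rpow_add hN _ _).symm
    have h5 : (c + 2 + 2 * g) * √n ≤ (n : ℝ) ^ (-(1 / 2) + ε / 64) *
        (η * n / (Nat.log 2 n + 1)) := by
      rw [← mul_div_assoc, le_div_iff₀ (by positivity), Real.sqrt_eq_rpow]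
      rw [div_mul_eq_mul_div, div_le_iff₀ hη0] at h2
      calc (c + 2 + 2 * g) * (n : ℝ) ^ (1 / 2 : ℝ) * (Nat.log 2 n + 1)
          ≤ (c + 2 + 2 * g) * (n : ℝ) ^ (1 / 2 : ℝ) * (n : ℝ) ^ (ε / 128) := by gcongr
        _ = (c + 2 + 2 * g) * (n : ℝ) ^ (1 / 2 + ε / 128) := by rw [mul_assoc, e3]
        _ ≤ _ := h2
        _ = _ := by rw [← e1]; ring
    have e4 : 2 * ((n : ℝ) ^ (-(1 / 2) + ε / 64)) ^ 2 * (n : ℝ) ^ (1 / 2 - ε / 32) * g * n =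
        2 * g * √n := by rw [← e2]; ring
    rw [e4]
    calc _ ≤ (2 * (n : ℝ) + 1) ^ 1 * Real.exp (-((c + 2) * √n)) := by
          gcongr
          · linarith
          · linarith
      _ ≤ Real.exp √n * Real.exp (-((c + 2) * √n)) := by
          gcongr
          refine (two_mul_add_one_pow_le hn3).trans (Real.exp_le_exp.2 ?_)
          rw [Real.sqrt_eq_rpow]
          push_cast
          linarith
      _ = _ := by rw [← Real.exp_add]; congr 1; ring

lemma exists_decays_highSum (hd : 5 ≤ d) {y : ℝ} (hy : 0 < y) : ∃ c : ℝ, 0 < c ∧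
    Decays c fun n => walkLaw d {ω | n * y ≤ highSum n ((n : ℝ) ^ (3 / 8 : ℝ)) ω} := by
  have : NeZero d := ⟨by omega⟩
  obtain ⟨C, hC⟩ := exists_potential_indicator_le hd
  have hC0 := hC.1
  obtain ⟨c, hc, h⟩ := exists_measure_highSum_ge_le hC hy
  refine ⟨c / 2, by positivity, ?_⟩
  filter_upwards [eventually_ge_atTop 3,
    eventually_mul_log_le (δ := 1 / 8) (by norm_num) (K := 8 * (d + 1) / c) (by positivity),
    eventually_mul_rpow_le (δ := 1 / 2) (δ' := 37 / 72) (by norm_num) (c * (2 * C))]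
    with n hn3 h1 h2
  have hN3 : (3 : ℝ) ≤ n := by exact_mod_cast hn3
  have hN : (0 : ℝ) < n := by linarith
  have hq : 1 ≤ (n : ℝ) ^ (1 / 4 : ℝ) := Real.one_le_rpow (by linarith) (by norm_num)
  -- `J` must be large enough that `J` sites above `n^(3/8)` cost more than `√n`, here `3/8 +
  -- (1/4)(5/9) = 37/72 > 1/2`, and small enough that the entropy `J log n` is below `√n`.
  set J : ℕ := ⌈(n : ℝ) ^ (1 / 4 : ℝ)⌉₊ with hJ
  have hJ1 : (n : ℝ) ^ (1 / 4 : ℝ) ≤ J := Nat.le_ceil _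
  have hJ2 : (J : ℝ) ≤ 2 * (n : ℝ) ^ (1 / 4 : ℝ) := by
    have := Nat.ceil_lt_add_one (a := (n : ℝ) ^ (1 / 4 : ℝ)) (by positivity)
    linarith
  have hJ0 : 0 < J := Nat.ceil_pos.2 (by positivity)
  refine (h n J _ (by omega) hJ0).trans (ENNReal.ofReal_le_ofReal ?_)
  have h3 : c * √n ≤ (n : ℝ) ^ (3 / 8 : ℝ) * (J : ℝ) ^ (5 / 9 : ℝ) / (2 * C) := by
    rw [le_div_iff₀ (by positivity), Real.sqrt_eq_rpow]
    calc c * (n : ℝ) ^ (1 / 2 : ℝ) * (2 * C) = c * (2 * C) * (n : ℝ) ^ (1 / 2 : ℝ) := by ring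
      _ ≤ (n : ℝ) ^ (37 / 72 : ℝ) := h2
      _ = (n : ℝ) ^ (3 / 8 : ℝ) * ((n : ℝ) ^ (1 / 4 : ℝ)) ^ (5 / 9 : ℝ) := by
          rw [← Real.rpow_mul hN.le, ← Real.rpow_add hN]; norm_num
      _ ≤ _ := by gcongr
  have hlog : 0 ≤ Real.log n := Real.log_nonneg (by linarith)
  -- The number of candidate sets and the remaining prefactors consume at most half of the rate `c`.
  have h4 : (2 * (n : ℝ) + 1) ^ (d * J + 2) ≤ Real.exp (c / 2 * √n) := by
    refine (two_mul_add_one_pow_le hn3).trans (Real.exp_le_exp.2 ?_)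
    rw [div_mul_eq_mul_div, div_le_iff₀ hc] at h1
    push_cast
    calc ((d : ℝ) * J + 2) * (2 * Real.log n)
        ≤ ((d : ℝ) * (2 * (n : ℝ) ^ (1 / 4 : ℝ)) + 2 * (n : ℝ) ^ (1 / 4 : ℝ)) *
          (2 * Real.log n) := by
          gcongr; linarith
      _ = (8 * (d + 1) * Real.log n) * (n : ℝ) ^ (1 / 4 : ℝ) / 2 := by ring
      _ ≤ ((n : ℝ) ^ (1 / 8 : ℝ) * c) * (n : ℝ) ^ (1 / 4 : ℝ) / 2 := by
          have := mul_le_mul_of_nonneg_right h1 (by positivity : 0 ≤ (n : ℝ) ^ (1 / 4 : ℝ))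
          linarith
      _ = c / 2 * (n : ℝ) ^ (3 / 8 : ℝ) := by
          rw [show (3 / 8 : ℝ) = 1 / 8 + 1 / 4 by norm_num, Real.rpow_add hN]; ring
      _ ≤ c / 2 * √n := by
          rw [Real.sqrt_eq_rpow]
          refine mul_le_mul_of_nonneg_left ?_ (by positivity)
          exact Real.rpow_le_rpow_of_exponent_le (by linarith) (by norm_num)
  have h5 : (n : ℝ) ^ (1 / 4 : ℝ) ≤ n := by
    conv_rhs => rw [← Real.rpow_one (n : ℝ)]
    exact Real.rpow_le_rpow_of_exponent_le (by linarith) (by norm_num)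
  calc _ ≤ (2 * (n : ℝ) + 1) ^ (d * J) * (2 * Real.exp (-(c * √n))) +
        J * ((2 * n + 1) ^ (d * J) * (2 * Real.exp (-(c * √n)))) := by gcongr
    _ = (2 * J + 2) * ((2 * (n : ℝ) + 1) ^ (d * J) * Real.exp (-(c * √n))) := by ring
    _ ≤ (2 * (n : ℝ) + 1) ^ 2 * ((2 * (n : ℝ) + 1) ^ (d * J) * Real.exp (-(c * √n))) := by
        gcongr
        nlinarith
    _ = (2 * (n : ℝ) + 1) ^ (d * J + 2) * Real.exp (-(c * √n)) := by ring
    _ ≤ Real.exp (c / 2 * √n) * Real.exp (-(c * √n)) := by gcongr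
    _ = _ := by rw [← Real.exp_add]; congr 1; ring

/-! ### Assembling the two estimates -/

lemma highSum_anti (n : ℕ) {t t' : ℝ} (h : t ≤ t') (ω : ℕ → Step d) :
    highSum n t' ω ≤ highSum n t ω := by
  rw [highSum_eq, highSum_eq]
  refine Finset.sum_le_sum_of_subset_of_nonneg ?_ fun _ _ _ => by positivity
  exact Finset.monotone_filter_right _ fun x _ hx => lt_of_le_of_lt h hx

lemma highSum_le_lowSum_add (n : ℕ) (t T : ℝ) (ω : ℕ → Step d) :
    highSum n t ω ≤ lowSum n T ω + highSum n T ω := by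
  have h1 : lowSum n T ω + highSum n T ω = ∑ x ∈ visited n ω, (localTime n x ω : ℝ) ^ 2 := by
    rw [lowSum_eq, highSum_eq]
    simp_rw [← not_le]
    exact Finset.sum_filter_add_sum_filter_not _ _ _
  rw [h1, highSum_eq]
  exact Finset.sum_le_sum_of_subset_of_nonneg (Finset.filter_subset _ _)
    fun _ _ _ => by positivity

lemma highSum_le_midSum_add (n : ℕ) (M T : ℝ) (ω : ℕ → Step d) :
    highSum n M ω ≤ ∑ x ∈ (visited n ω).filter
      (fun x => M < (localTime n x ω : ℝ) ∧ (localTime n x ω : ℝ) ≤ T),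
      (localTime n x ω : ℝ) ^ 2 + highSum n T ω := by
  classical
  rw [highSum_eq, highSum_eq]
  rw [← Finset.sum_filter_add_sum_filter_not ((visited n ω).filter
    fun x => M < (localTime n x ω : ℝ)) (fun x => (localTime n x ω : ℝ) ≤ T), Finset.filter_filter]
  gcongr
  intro x hx
  simp only [Finset.mem_filter, not_le] at hx ⊢
  exact ⟨hx.1.1, hx.2⟩

lemma decays_lowSum (hd : 5 ≤ d) {ε : ℝ} (hε : 0 < ε) {y : ℝ}
    (hy : 1 + 2 * (∑' x, green d x ^ 2).toReal < y) {c : ℝ} (hc : 0 < c) :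
    Decays c fun n => walkLaw d {ω | n * y ≤ lowSum n ((n : ℝ) ^ (1 / 2 - ε)) ω} := by
  set g := (∑' x, green d x ^ 2).toReal with hg
  -- The midpoint of `g` and `(y - 1) / 2`: it stays above the mean, and the slack `n (y - 1 - 2a)`
  -- absorbs the extra `1` in `n + 1`.
  set a : ℝ := (g + (y - 1) / 2) / 2 with ha
  refine Decays.of_le (decays_sum_dyadicCross hd hε 0 (a := a) ?_ hc) ?_
  · rw [← hg, ha]
    norm_num
    linarith
  · have h1 : 0 < y - 1 - 2 * a := by rw [ha]; linarith
    filter_upwards [tendsto_natCast_atTop_atTop.eventually_ge_atTop (1 / (y - 1 - 2 * a))]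
      with n hn
    refine measure_mono fun ω hω => ?_
    rw [Set.mem_ofPred_eq] at hω ⊢
    have h2 := hω.trans (lowSum_le n (T := (n : ℝ) ^ (1 / 2 - ε)) (by positivity) ω)
    rw [div_le_iff₀ h1] at hn
    linarith

/-- A union bound in which `X` is negligible at every rate, so only the sites above `n^(3/8)`
determine the constant. -/
lemma exists_sqrtRate_le_of_le_add (hd : 5 ≤ d) {t y₁ y₂ : ℝ} (hy₂ : 0 < y₂)
    {Y : ℕ → (ℕ → Step d) → ℝ} {X : ℕ → (ℕ → Step d) → ℝ}
    (hX : ∀ c, 0 < c → Decays c fun n => walkLaw d {ω | n * y₁ ≤ X n ω}) (ht : t = y₁ + y₂)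
    (h : ∀ᶠ n : ℕ in atTop, ∀ ω, Y n ω ≤ X n ω + highSum n ((n : ℝ) ^ (3 / 8 : ℝ)) ω) :
    ∃ c : ℝ, 0 < c ∧
      sqrtRate (fun n => walkLaw d {ω | (n : ℝ) * t ≤ Y n ω}) ≤ ((-c : ℝ) : EReal) := by
  obtain ⟨c, hc, hD⟩ := exists_decays_highSum hd hy₂
  refine ⟨c / 2, by positivity, sqrtRate_le_of_decays ?_⟩
  refine Decays.of_le (Decays.add (half_lt_self hc) (hX c hc) hD) ?_
  filter_upwards [h] with n hn
  refine le_trans (measure_mono fun ω hω => ?_) (measure_union_le _ _)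
  by_contra hcon
  simp only [Set.mem_union, Set.mem_ofPred_eq, not_or, not_le] at hcon hω
  have h1 := hn ω
  rw [ht, mul_add] at hω
  linarith [hcon.1, hcon.2]

lemma one_add_two_mul_toReal_lt (hd : 5 ≤ d) {y : ℝ}
    (hy : 1 + 2 * ∑' x : Fin d → ℤ, green d x ^ 2 < ENNReal.ofReal y) :
    1 + 2 * (∑' x : Fin d → ℤ, green d x ^ 2).toReal < y := by
  rw [← ENNReal.ofReal_toReal (tsum_green_sq_ne_top hd), ← ENNReal.ofReal_one,
    ← ENNReal.ofReal_ofNat 2, ← ENNReal.ofReal_mul (by norm_num),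
    ← ENNReal.ofReal_add (by norm_num) (by positivity)] at hy
  exact (ENNReal.ofReal_lt_ofReal_iff'.1 hy).1

end SimpleWalk

end

theorem proposition1p4 (d : ℕ) (hd : 5 ≤ d) :
    (∀ ε : ℝ, 0 < ε → ∀ y : ℝ,
      1 + 2 * ∑' x : Fin d → ℤ, SimpleWalk.green d x ^ 2 < ENNReal.ofReal y →
      SimpleWalk.sqrtRate (fun n => SimpleWalk.walkLaw d
        {ω | (n : ℝ) * y ≤ SimpleWalk.lowSum n ((n : ℝ) ^ (1 / 2 - ε)) ω}) = ⊥) ∧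
    (∀ y : ℝ, 0 < y → ∀ ε : ℝ, 0 < ε →
      (ε < 1 / 2 ∨
        1 + 2 * ∑' x : Fin d → ℤ, SimpleWalk.green d x ^ 2 < ENNReal.ofReal y) →
      ∃ c : ℝ, 0 < c ∧
        SimpleWalk.sqrtRate (fun n => SimpleWalk.walkLaw d
          {ω | (n : ℝ) * y ≤ SimpleWalk.highSum n ((n : ℝ) ^ (1 / 2 - ε)) ω})
          ≤ ((-c : ℝ) : EReal)) := by
  have e : (1 / 2 - 1 / 8 : ℝ) = 3 / 8 := by norm_num
  refine ⟨fun ε hε y hy => SimpleWalk.sqrtRate_eq_bot_of_decays fun c hc =>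
    SimpleWalk.decays_lowSum hd hε (SimpleWalk.one_add_two_mul_toReal_lt hd hy) hc, ?_⟩
  rintro y hy ε hε (hε' | hy')
  · set g := (∑' x : Fin d → ℤ, SimpleWalk.green d x ^ 2).toReal with hg
    -- The intermediate sites receive half of `y`, and `midSum_le` costs a factor four; hence the
    -- mean `g / 2^l₀` must be below `y / 8`.
    obtain ⟨l₀, hl₀⟩ := pow_unbounded_of_one_lt (8 * g / y) (one_lt_two : (1 : ℝ) < 2)
    have ha : g / 2 ^ l₀ < y / 8 := by
      rw [div_lt_iff₀ hy] at hl₀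
      rw [div_lt_iff₀ (by positivity)]
      linarith
    refine SimpleWalk.exists_sqrtRate_le_of_le_add hd (half_pos hy)
      (X := fun n ω => 4 * ∑ l ∈ Finset.Ico l₀ (Nat.log 2 n + 1),
        ∑ k ∈ Finset.range (SimpleWalk.numBlocks n l),
          SimpleWalk.dyadicCross ((n : ℝ) ^ (1 / 2 - 1 / 8 : ℝ)) l k ω)
      (fun c hc => ?_) (add_halves y).symm ?_
    · refine SimpleWalk.Decays.of_le
        (SimpleWalk.decays_sum_dyadicCross hd (by norm_num : (0 : ℝ) < 1 / 8) l₀ ha hc) ?_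
      filter_upwards with n
      refine MeasureTheory.measure_mono fun ω hω => ?_
      rw [Set.mem_ofPred_eq] at hω ⊢
      linarith
    -- Since `ε < 1/2`, the threshold `n^(1/2-ε)` eventually exceeds the constant `4 * 2^l₀` and may
    -- be lowered to it.
    · filter_upwards [SimpleWalk.eventually_le_rpow (sub_pos.2 hε') (4 * 2 ^ l₀)] with n hn ω
      refine (SimpleWalk.highSum_anti n hn ω).trans
        ((SimpleWalk.highSum_le_midSum_add n _ ((n : ℝ) ^ (3 / 8 : ℝ)) ω).trans ?_)
      gcongr
      rw [e]
      exact SimpleWalk.midSum_le n l₀ (by positivity) le_rfl ω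
  · have hy1 := SimpleWalk.one_add_two_mul_toReal_lt hd hy'
    set g := (∑' x : Fin d → ℤ, SimpleWalk.green d x ^ 2).toReal with hg
    -- The share `y₁` of the low sites is halfway between `1 + 2g` and `y`, so the first claim
    -- applies to it and a positive share is left for the high sites.
    refine SimpleWalk.exists_sqrtRate_le_of_le_add hd (y₁ := (y + (1 + 2 * g)) / 2)
      (y₂ := (y - (1 + 2 * g)) / 2) (by linarith)
      (X := fun n ω => SimpleWalk.lowSum n ((n : ℝ) ^ (1 / 2 - 1 / 8 : ℝ)) ω)
      (fun c hc => SimpleWalk.decays_lowSum hd (by norm_num) (by rw [← hg]; linarith) hc)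
      (by ring) ?_
    filter_upwards with n ω
    rw [e]
    exact SimpleWalk.highSum_le_lowSum_add n _ _ ω
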